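/- A relation algebra is a Boolean algebra $A$ with an associative binary operation $;$ (relative multiplication), a unary operation ${}^\smile$ (converse) and a constant $1'$ such that $r;1'=r$, $r^{\smile\smile}=r$, $(r;s)^\smile=s^\smile;r^\smile$, $(r+s);t=r;t+s;t$, $(r+s)^\smile=r^\smile+s^\smile$ and $r^\smile;-(r;s)+(-s)=-s$. An element $f$ is a function if $f^\smile;f\le 1'$. An atom $x\le 1'$ is measurable if $x;1;x$ is the sum (supremum) of a set of functions, and $A$ is measurable if $1'$ is the sum of a set of measurable atoms. A set relation algebra is a set of subrelations of an equivalence relation $E$ on a set $U$ that contains the identity relation on $U$ and is closed under union, complement relative to $E$, relational composition and converse. $A$ is representable if it is isomorphic to a set relation algebra, and completely representable if there is such an isomorphism under which every existing supremum in $A$ is mapped to the union of the images. A frame consists of a system of disjoint groups $(G_x)_{x\in I}$, an equivalence relation $\mathcal E$ on $I$, and, for each $(x,y)\in\mathcal E$, normal subgroups $H_{xy}$ of $G_x$ and $K_{xy}$ of $G_y$ and an isomorphism $\varphi_{xy}\colon G_x/H_{xy}\to G_y/K_{xy}$, such that (i) $\varphi_{xx}$ is the identity automorphism of $G_x/\{e_x\}$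 for all $x\in I$; (ii) $\varphi_{yx}=\varphi_{xy}^{-1}$ for $(x,y)\in\mathcal E$; and, whenever $(x,y),(y,z)\in\mathcal E$, (iii) $\varphi_{xy}[H_{xy}H_{xz}]=K_{xy}H_{yz}$ and (iv) $\hat\varphi_{yz}\circ\hat\varphi_{xy}=\hat\varphi_{xz}$, where $\hat\varphi_{xy}$, $\hat\varphi_{yz}$, $\hat\varphi_{xz}$ are the isomorphisms induced by $\varphi_{xy}$, $\varphi_{yz}$, $\varphi_{xz}$ on $G_x/(H_{xy}H_{xz})$, $G_y/(K_{xy}H_{yz})$, $G_x/(H_{xy}H_{xz})$ respectively. The group relation algebra on the frame is the set relation algebra with base set $U=\bigcup_{x\in I}G_x$ and unit $E=\bigcup_{(x,y)\in\mathcal E}G_x\times G_y$ whose elements are all unions of sets of the relations $$R_{xy,\kappa}=\bigcup_{\gamma\in G_x/H_{xy}}\gamma\times(\varphi_{xy}(\gamma)\,\kappa),\qquad (x,y)\in\mathcal E,\ \kappa\in G_y/K_{xy}.$$ $A$ is essentially isomorphic to $C$ if the completion (minimal complete extension) of $A$, i.e. the complete relation algebra that contains $A$ as a subalgebra and in which every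 nonzero element lies above a nonzero element of $A$, is isomorphic to $C$. **Statement.** A measurable relation algebra is completely representable if and only if it is essentially isomorphic to a group relation algebra. Moreover, every finite representable measurable relation algebra is isomorphic to a group relation algebra. -/

import Mathlib

open scoped Pointwise SetRel

universe u

/-! ### Abstract relation algebras -/

/-- A relation algebra: a Boolean algebra with relative multiplication `r ⨟ s`, converse and a
distinguished identity element. -/
class RelationAlgebra (A : Type u) extends BooleanAlgebra A where
  rmul : A → A → A
  conv : A → A
  ident : A
  rmul_assoc : ∀ r s t : A, rmul r (rmul s t) = rmul (rmul r s) t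
  rmul_ident : ∀ r : A, rmul r ident = r
  conv_conv : ∀ r : A, conv (conv r) = r
  conv_rmul : ∀ r s : A, conv (rmul r s) = rmul (conv s) (conv r)
  sup_rmul : ∀ r s t : A, rmul (r ⊔ s) t = rmul r t ⊔ rmul s t
  conv_sup : ∀ r s : A, conv (r ⊔ s) = conv r ⊔ conv s
  /-- Tarski's law. -/
  tarski : ∀ r s : A, rmul (conv r) (rmul r s)ᶜ ⊔ sᶜ = sᶜ

namespace RelationAlgebra

infixl:75 " ⨟ " => RelationAlgebra.rmul

variable {A B : Type u} [RelationAlgebra A] [RelationAlgebra B]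

/-- `f` is a function (a functional element). -/
def IsFunctional (f : A) : Prop := conv f ⨟ f ≤ ident

/-- A measurable atom: a subidentity atom whose square is a sum of functional elements. -/
def IsMeasurableAtom (x : A) : Prop :=
  IsAtom x ∧ x ≤ ident ∧ ∃ F : Set A, (∀ f ∈ F, IsFunctional f) ∧ IsLUB F (x ⨟ ⊤ ⨟ x)

/-- A relation algebra is measurable if its identity is the sum of measurable atoms. -/
def IsMeasurableAlgebra (A : Type u) [RelationAlgebra A] : Prop :=
  ∃ X : Set A, (∀ x ∈ X, IsMeasurableAtom x) ∧ IsLUB X (ident : A)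

/-- Homomorphisms of relation algebras. -/
structure IsHom (f : A → B) : Prop where
  map_sup : ∀ a b, f (a ⊔ b) = f a ⊔ f b
  map_compl : ∀ a, f aᶜ = (f a)ᶜ
  map_rmul : ∀ a b, f (a ⨟ b) = f a ⨟ f b
  map_conv : ∀ a, f (conv a) = conv (f a)
  map_ident : f ident = ident

def IsIso (f : A → B) : Prop := IsHom f ∧ Function.Bijective f

def Isomorphic (A B : Type u) [RelationAlgebra A] [RelationAlgebra B] : Prop :=
  ∃ f : A → B, IsIso f

/-- Every set of elements has a sum. -/
def IsComplete (A : Type u) [RelationAlgebra A] : Prop := ∀ X : Set A, ∃ a : A, IsLUB X a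

/-- `e : B → A` exhibits `A` as the completion (minimal complete extension) of `B`:
`A` is complete, `e` is an embedding, and the image of `B` is dense in `A`. -/
structure IsCompletion (e : B → A) : Prop where
  complete : IsComplete A
  hom : IsHom e
  injective : Function.Injective e
  dense : ∀ a : A, a ≠ ⊥ → ∃ b : B, b ≠ ⊥ ∧ e b ≤ a

/-- `B` is essentially isomorphic to `C`: the completion of `B` is isomorphic to `C`. -/
def EssentiallyIsomorphic (B C : Type u) [RelationAlgebra B] [RelationAlgebra C] : Prop :=
  ∃ (A : Type u) (_ : RelationAlgebra A) (e : B → A), IsCompletion e ∧ Isomorphic A C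

end RelationAlgebra

/-! ### Set relation algebras and representations -/

/-- A set relation algebra on the base set `U`: a set of subrelations of an equivalence relation
`E` on `U` that is closed under union, complement relative to `E`, relational composition and
converse, and that contains the identity relation on `U`. -/
structure SetRelationAlgebra (U : Type u) where
  E : Setoid U
  carrier : Set (SetRel U U)
  rel_of_mem : ∀ R ∈ carrier, ∀ p q : U, (p, q) ∈ R → E p q
  union_mem : ∀ R ∈ carrier, ∀ S ∈ carrier, R ∪ S ∈ carrier
  compl_mem : ∀ R ∈ carrier, {p : U × U | E p.1 p.2 ∧ p ∉ R} ∈ carrier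
  comp_mem : ∀ R ∈ carrier, ∀ S ∈ carrier, R ○ S ∈ carrier
  inv_mem : ∀ R ∈ carrier, R.inv ∈ carrier
  id_mem : SetRel.id ∈ carrier

namespace SetRelationAlgebra

variable {U : Type u} (S : SetRelationAlgebra U)

/-- The universe of the algebra, as a type. -/
def Elem : Type u := {R : SetRel U U // R ∈ S.carrier}

variable {S} in
/-- The underlying binary relation of an element. -/
def Elem.rel (R : S.Elem) : SetRel U U := R.1

theorem Elem.ext {R T : S.Elem} (h : ∀ p : U × U, p ∈ R.rel ↔ p ∈ T.rel) : R = T :=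
  Subtype.ext (Set.ext h)

theorem Elem.related (R : S.Elem) {p : U × U} (h : p ∈ R.rel) : S.E p.1 p.2 :=
  S.rel_of_mem R.1 R.2 p.1 p.2 h

theorem unit_mem : {p : U × U | S.E p.1 p.2} ∈ S.carrier := by
  have h := S.union_mem _ S.id_mem _ (S.compl_mem _ S.id_mem)
  convert h using 1
  ext p
  simp only [Set.mem_ofPred_eq, Set.mem_union]
  constructor
  · intro hp
    by_cases h : p ∈ (SetRel.id : SetRel U U)
    · exact Or.inl h
    · exact Or.inr ⟨hp, h⟩
  · rintro (hp | hp)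
    · exact S.rel_of_mem _ S.id_mem p.1 p.2 hp
    · exact hp.1

theorem empty_mem : (∅ : Set (U × U)) ∈ S.carrier := by
  have h := S.compl_mem _ S.unit_mem
  convert h using 1
  ext p
  simp

theorem inter_mem (R : SetRel U U) (hR : R ∈ S.carrier) (T : SetRel U U) (hT : T ∈ S.carrier) :
    (R ∩ T : Set (U × U)) ∈ S.carrier := by
  have h := S.compl_mem _ (S.union_mem _ (S.compl_mem _ hR) _ (S.compl_mem _ hT))
  convert h using 1
  ext p
  have h1 := S.rel_of_mem R hR p.1 p.2
  simp only [Set.mem_inter_iff, Set.mem_ofPred_eq, Set.mem_union]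
  tauto

/-- The operations are union, complement relative to the unit, relational composition, converse
of relations and the identity relation; the order is inclusion. -/
instance : RelationAlgebra S.Elem where
  le R T := ∀ p, p ∈ R.rel → p ∈ T.rel
  le_refl R p h := h
  le_trans R T V h h' p hp := h' p (h p hp)
  le_antisymm R T h h' := Elem.ext S fun p => ⟨h p, h' p⟩
  sup R T := ⟨R.1 ∪ T.1, S.union_mem _ R.2 _ T.2⟩
  le_sup_left R T p h := Or.inl h
  le_sup_right R T p h := Or.inr h
  sup_le R T V h h' p hp := hp.elim (h p) (h' p)
  inf R T := ⟨R.1 ∩ T.1, S.inter_mem _ R.2 _ T.2⟩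
  inf_le_left R T p h := h.1
  inf_le_right R T p h := h.2
  le_inf R T V h h' p hp := ⟨h p hp, h' p hp⟩
  le_sup_inf R T V p hp := by
    rcases hp with ⟨h1 | h1, h2 | h2⟩
    · exact Or.inl h1
    · exact Or.inl h1
    · exact Or.inl h2
    · exact Or.inr ⟨h1, h2⟩
  compl R := ⟨{p | S.E p.1 p.2 ∧ p ∉ R.1}, S.compl_mem _ R.2⟩
  top := ⟨{p | S.E p.1 p.2}, S.unit_mem⟩
  bot := ⟨∅, S.empty_mem⟩
  inf_compl_le_bot R p h := h.2.2 h.1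
  top_le_sup_compl R p h := by
    by_cases hp : p ∈ R.1
    · exact Or.inl hp
    · exact Or.inr ⟨h, hp⟩
  le_top R p h := R.related S h
  bot_le R p h := h.elim
  rmul R T := ⟨R.1 ○ T.1, S.comp_mem _ R.2 _ T.2⟩
  conv R := ⟨R.1.inv, S.inv_mem _ R.2⟩
  ident := ⟨SetRel.id, S.id_mem⟩
  rmul_assoc R T V := Subtype.ext (SetRel.comp_assoc _ _ _).symm
  rmul_ident R := Subtype.ext (SetRel.comp_id _)
  conv_conv R := Subtype.ext SetRel.inv_inv
  conv_rmul R T := Subtype.ext (SetRel.inv_comp _ _)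
  sup_rmul R T V := Elem.ext S fun p => by
    constructor
    · rintro ⟨b, h1 | h1, h2⟩
      · exact Or.inl ⟨b, h1, h2⟩
      · exact Or.inr ⟨b, h1, h2⟩
    · rintro (⟨b, h1, h2⟩ | ⟨b, h1, h2⟩)
      · exact ⟨b, Or.inl h1, h2⟩
      · exact ⟨b, Or.inr h1, h2⟩
  conv_sup R T := Elem.ext S fun p => Iff.rfl
  tarski R T := Elem.ext S fun p => by
    constructor
    · rintro (⟨b, h1, h2, h3⟩ | h)
      · exact ⟨S.E.trans (S.E.symm (S.rel_of_mem _ R.2 _ _ h1)) h2, fun h4 => h3 ⟨_, h1, h4⟩⟩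
      · exact h
    · exact Or.inr

end SetRelationAlgebra

namespace RelationAlgebra

/-- `A` is isomorphic to a set relation algebra. -/
def Representable (A : Type u) [RelationAlgebra A] : Prop :=
  ∃ (U : Type u) (S : SetRelationAlgebra U), Isomorphic A S.Elem

/-- `A` has a complete representation: an isomorphism `θ` onto a set relation algebra under which
every existing sum is mapped to the union of the images of the summands. -/
def CompletelyRepresentable (A : Type u) [RelationAlgebra A] : Prop :=
  ∃ (U : Type u) (S : SetRelationAlgebra U) (θ : A → S.Elem), IsIso θ ∧
    ∀ (X : Set A) (a : A), IsLUB X a → (θ a).rel = ⋃ b ∈ X, (θ b).rel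

end RelationAlgebra

/-! ### Group relation algebras -/

/-- A group pair: a system of groups `G x` (`x` in `I`), an equivalence relation on `I`, and for
each pair `x, y` of equivalent indices an isomorphism `φ x y` from a quotient `G x ⧸ H x y` to a
quotient `G y ⧸ K x y`.
(The values of `H x y` and `K x y` for inequivalent `x, y` are never used.) -/
structure GroupPair (I : Type u) (G : I → Type u) [∀ x, Group (G x)] where
  equiv : Setoid I
  H : ∀ x _y : I, Subgroup (G x)
  K : ∀ _x y : I, Subgroup (G y)
  normal_H : ∀ x y, (H x y).Normal
  normal_K : ∀ x y, (K x y).Normal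
  φ : ∀ x y : I, equiv x y → (G x ⧸ H x y) ≃* (G y ⧸ K x y)

attribute [instance] GroupPair.normal_H GroupPair.normal_K

namespace GroupPair

variable {I : Type u} {G : I → Type u} [∀ x, Group (G x)] (P : GroupPair I G)

/-- For a union `X` of cosets of `H x y`, the union of the images under `φ x y` of the cosets of
`H x y` that make up `X`. -/
def image {x y : I} (h : P.equiv x y) (X : Set (G x)) : Set (G y) :=
  {k | ∃ g ∈ X, P.φ x y h (QuotientGroup.mk g) = QuotientGroup.mk k}

/-- The frame conditions. In `comp`, the induced isomorphism of quotients sends a coset of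
`H x y * H x z` to the union of the images of the cosets of `H x y` (respectively `H x z`)
contained in it; the condition says that the isomorphism induced by `φ x y` followed by the one
induced by `φ y z` is the one induced by `φ x z`. -/
structure IsFrame : Prop where
  /-- `φ x x` is the identity automorphism of `G x ⧸ {e}`. -/
  H_self : ∀ x, P.H x x = ⊥
  K_self : ∀ x, P.K x x = ⊥
  φ_self : ∀ x (g : G x), P.φ x x (P.equiv.refl x) (QuotientGroup.mk g) = QuotientGroup.mk g
  /-- `φ y x` is the inverse of `φ x y`. -/
  H_symm : ∀ x y, P.equiv x y → P.H y x = P.K x y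
  K_symm : ∀ x y, P.equiv x y → P.K y x = P.H x y
  φ_symm : ∀ x y (h : P.equiv x y) (g : G x) (k : G y),
    P.φ x y h (QuotientGroup.mk g) = QuotientGroup.mk k ↔
      P.φ y x (P.equiv.symm h) (QuotientGroup.mk k) = QuotientGroup.mk g
  /-- `φ x y` maps `H x y * H x z` to `K x y * H y z`. -/
  image_mul : ∀ x y z (h : P.equiv x y) (_ : P.equiv y z),
    P.image h ((P.H x y : Set (G x)) * (P.H x z : Set (G x))) =
      (P.K x y : Set (G y)) * (P.H y z : Set (G y))
  comp : ∀ x y z (h : P.equiv x y) (h' : P.equiv y z) (g : G x),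
    P.image h' (P.image h (g • ((P.H x y : Set (G x)) * (P.H x z : Set (G x))))) =
      P.image (P.equiv.trans h h') (g • ((P.H x y : Set (G x)) * (P.H x z : Set (G x))))

/-- The base set: the disjoint union of the groups. -/
abbrev Base (_P : GroupPair I G) : Type u := Σ x, G x

/-- The atomic relation with index a coset `κ` of `K x y`: the union of the relations
`γ × (φ x y γ * κ)` over all cosets `γ` of `H x y` in `G x`. -/
def atom {x y : I} (h : P.equiv x y) (κ : G y ⧸ P.K x y) : SetRel P.Base P.Base :=
  {p | ∃ (g : G x) (k : G y), p = (⟨x, g⟩, ⟨y, k⟩) ∧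
    P.φ x y h (QuotientGroup.mk g) * κ = QuotientGroup.mk k}

/-- The set of all atomic relations. -/
def atoms : Set (SetRel P.Base P.Base) :=
  {R | ∃ (x y : I) (h : P.equiv x y) (κ : G y ⧸ P.K x y), R = P.atom h κ}

/-- All unions of sets of atomic relations. -/
def unions : Set (SetRel P.Base P.Base) :=
  {R | ∃ T ⊆ P.atoms, R = ⋃₀ T}

/-- The union of the sets `G x × G y` over all equivalent `x`, `y`. -/
def baseSetoid : Setoid P.Base := P.equiv.comap Sigma.fst

theorem mem_unions_iff (R : SetRel P.Base P.Base) : R ∈ P.unions ↔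
    (∀ p q, (p, q) ∈ R → P.baseSetoid p q) ∧
    ∀ x y (h : P.equiv x y) (g g' : G x) (k k' : G y),
      (P.φ x y h (QuotientGroup.mk g))⁻¹ * QuotientGroup.mk k =
        (P.φ x y h (QuotientGroup.mk g'))⁻¹ * QuotientGroup.mk k' →
      ((⟨x, g⟩, ⟨y, k⟩) : P.Base × P.Base) ∈ R → ((⟨x, g'⟩, ⟨y, k'⟩) : P.Base × P.Base) ∈ R := by
  constructor
  · rintro ⟨T, hT, rfl⟩
    refine ⟨?_, ?_⟩
    · rintro p q ⟨a, ha, hp⟩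
      obtain ⟨x, y, h, κ, rfl⟩ := hT ha
      obtain ⟨g, k, hpq, -⟩ := hp
      cases hpq
      exact h
    · rintro x y h g g' k k' he ⟨a, ha, hp⟩
      refine ⟨a, ha, ?_⟩
      obtain ⟨x', y', h', κ, rfl⟩ := hT ha
      obtain ⟨g₁, k₁, hpq, hk⟩ := hp
      cases hpq
      refine ⟨g', k', rfl, ?_⟩
      rw [← hk] at he
      rw [inv_mul_cancel_left] at he
      rw [he, mul_inv_cancel_left]
  · rintro ⟨h1, h2⟩
    refine ⟨{a | a ∈ P.atoms ∧ a ⊆ R}, fun a ha => ha.1, ?_⟩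
    ext ⟨⟨x, g⟩, ⟨y, k⟩⟩
    constructor
    · intro hp
      have h : P.equiv x y := h1 _ _ hp
      refine ⟨P.atom h ((P.φ x y h (QuotientGroup.mk g))⁻¹ * QuotientGroup.mk k),
        ⟨⟨x, y, h, _, rfl⟩, ?_⟩, g, k, rfl, mul_inv_cancel_left _ _⟩
      rintro p ⟨g', k', rfl, he⟩
      refine h2 x y h g g' k k' ?_ hp
      rw [← he, inv_mul_cancel_left]
    · rintro ⟨a, ⟨-, ha⟩, hp⟩
      exact ha hp

variable {P}

theorem IsFrame.inv_mem (hP : P.IsFrame) (R : SetRel P.Base P.Base) (hR : R ∈ P.unions) :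
    R.inv ∈ P.unions := by
  rw [mem_unions_iff] at hR ⊢
  obtain ⟨h1, h2⟩ := hR
  refine ⟨fun p q hp => P.baseSetoid.symm (h1 _ _ hp), ?_⟩
  intro y x h k k' g g' he hp
  refine h2 x y (P.equiv.symm h) g g' k k' ?_ hp
  obtain ⟨a, ha⟩ := QuotientGroup.mk_surjective (P.φ y x h (QuotientGroup.mk k))
  obtain ⟨a', ha'⟩ := QuotientGroup.mk_surjective (P.φ y x h (QuotientGroup.mk k'))
  rw [← ha, ← ha'] at he
  have e1 := (hP.φ_symm y x h k a).1 ha.symm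
  have e2 := (hP.φ_symm y x h k' a').1 ha'.symm
  rw [← e1, ← e2, ← map_inv, ← map_inv, ← map_mul, ← map_mul]
  congr 1
  have e3 : (QuotientGroup.mk (a⁻¹ * g) : G x ⧸ P.H x y) = QuotientGroup.mk (a'⁻¹ * g') := by
    rw [← QuotientGroup.mk_inv, ← QuotientGroup.mk_inv, ← QuotientGroup.mk_mul,
      ← QuotientGroup.mk_mul, QuotientGroup.eq] at he
    rw [QuotientGroup.eq]
    rwa [← hP.K_symm x y (P.equiv.symm h)]
  have e4 := congrArg (fun q => q⁻¹) e3
  simpa [QuotientGroup.mk_mul, QuotientGroup.mk_inv, mul_inv_rev] using e4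

theorem IsFrame.id_mem (hP : P.IsFrame) : SetRel.id ∈ P.unions := by
  rw [mem_unions_iff]
  refine ⟨?_, ?_⟩
  · rintro p q hpq
    have e : p = q := hpq
    rw [e]
  · rintro x y h g g' k k' he hp
    have hp' : (⟨x, g⟩ : P.Base) = ⟨y, k⟩ := hp
    cases hp'
    rw [hP.φ_self x, hP.φ_self x, inv_mul_cancel, ← QuotientGroup.mk_inv, ← QuotientGroup.mk_mul,
      eq_comm, QuotientGroup.eq_one_iff, hP.K_self, Subgroup.mem_bot] at he
    have e : g' = k' := by rw [← inv_mul_eq_one]; exact he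
    rw [e]
    rfl

theorem IsFrame.comp_mem (hP : P.IsFrame) (R : SetRel P.Base P.Base) (hR : R ∈ P.unions)
    (S : SetRel P.Base P.Base) (hS : S ∈ P.unions) : R ○ S ∈ P.unions := by
  rw [mem_unions_iff] at hR hS ⊢
  obtain ⟨r1, r2⟩ := hR
  obtain ⟨s1, s2⟩ := hS
  refine ⟨fun p q ⟨b, h, h'⟩ => P.baseSetoid.trans (r1 _ _ h) (s1 _ _ h'), ?_⟩
  rintro x z h g g' k k' he ⟨⟨y, m⟩, hR, hS⟩
  have hxy : P.equiv x y := r1 _ _ hR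
  have hyz : P.equiv y z := s1 _ _ hS
  have e1 : P.φ x z h (QuotientGroup.mk (g' * g⁻¹)) = QuotientGroup.mk (k' * k⁻¹) := by
    rw [QuotientGroup.mk_mul, QuotientGroup.mk_mul, map_mul, QuotientGroup.mk_inv,
      QuotientGroup.mk_inv, map_inv, eq_mul_inv_iff_mul_eq, mul_assoc, he, mul_inv_cancel_left]
  have e2 : k' * k⁻¹ ∈ P.image hyz (P.image hxy
      ((g' * g⁻¹) • ((P.H x y : Set (G x)) * (P.H x z : Set (G x))))) := by
    rw [hP.comp x y z hxy hyz]
    exact ⟨_, ⟨1, ⟨1, one_mem _, 1, one_mem _, mul_one 1⟩, mul_one _⟩, e1⟩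
  obtain ⟨d, ⟨p, ⟨w, hw, rfl⟩, hd⟩, hdz⟩ := e2
  obtain ⟨c, hc⟩ := QuotientGroup.mk_surjective (P.φ x y hxy (QuotientGroup.mk (g' * g⁻¹)))
  have e3 : c⁻¹ * d ∈ P.image hxy ((P.H x y : Set (G x)) * (P.H x z : Set (G x))) := by
    refine ⟨w, hw, ?_⟩
    rw [QuotientGroup.mk_mul, QuotientGroup.mk_inv, hc, ← hd]
    change _ = _ * P.φ x y hxy (QuotientGroup.mk ((g' * g⁻¹) * w))
    rw [QuotientGroup.mk_mul _ (g' * g⁻¹) w, map_mul, inv_mul_cancel_left]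
  rw [hP.image_mul x y z hxy hyz] at e3
  obtain ⟨n, hn, l, hl, hnl⟩ := e3
  have hd' : d = c * n * l := by
    have : n * l = c⁻¹ * d := hnl
    rw [mul_assoc, this, mul_inv_cancel_left]
  refine ⟨⟨y, c * n * m⟩, r2 x y hxy g g' m _ ?_ hR, s2 y z hyz m _ k k' ?_ hS⟩
  · have e4 : (QuotientGroup.mk (c * n) : G y ⧸ P.K x y) = QuotientGroup.mk c :=
      QuotientGroup.mk_mul_of_mem c hn
    rw [QuotientGroup.mk_mul _ (c * n) m, e4, hc, QuotientGroup.mk_mul, map_mul,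
      QuotientGroup.mk_inv, map_inv]
    group
  · have e5 : (QuotientGroup.mk (c * n) : G y ⧸ P.H y z) = QuotientGroup.mk d := by
      rw [hd']
      exact (QuotientGroup.mk_mul_of_mem _ hl).symm
    rw [QuotientGroup.mk_mul _ (c * n) m, e5, map_mul, hdz, QuotientGroup.mk_mul,
      QuotientGroup.mk_inv]
    group

/-- The group relation algebra on a frame. -/
def groupRelationAlgebra (P : GroupPair I G) (hP : P.IsFrame) : SetRelationAlgebra P.Base where
  E := P.baseSetoid
  carrier := P.unions
  rel_of_mem R hR := ((P.mem_unions_iff R).1 hR).1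
  union_mem := by
    rintro _ ⟨T, hT, rfl⟩ _ ⟨T', hT', rfl⟩
    exact ⟨T ∪ T', Set.union_subset hT hT', (Set.sUnion_union T T').symm⟩
  compl_mem R hR := by
    rw [mem_unions_iff] at hR ⊢
    refine ⟨fun p q h => h.1, fun x y h g g' k k' he hp => ⟨h, fun h' => hp.2 ?_⟩⟩
    exact hR.2 x y h g' g k' k he.symm h'
  comp_mem R hR S hS := hP.comp_mem R hR S hS
  inv_mem R hR := hP.inv_mem R hR
  id_mem := hP.id_mem

end GroupPair

/-! ### Frames from coherent families of subgroups (Goursat) -/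

namespace Subgroup

/-! Let `A` be measurable and completely represented by relations on `U`. An atom `x ≤ ident` makes
its points indistinguishable: whatever an element does at one point of `x` it does at all of them
(`exists_T_of_isAtom`). Hence a functional element below `x ⨟ ⊤ ⨟ x` permutes the points of `x`. By
measurability these permutations form a group `G x` acting simply transitively on the points of `x`
inside each class of the unit that meets `x` (`exists_isPerm`, `IsPerm.eq_of_T`).

Complete representations are atomic (`exists_isAtom`). Choose base points coherently
(`exists_base`), identify `g` in `G x` with the translate `pt g` of the base point, and let `at₂ x
y` be the atom joining the base points of `x` and `y`. The pairs `(g, k)` whose translates are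
related by `at₂ x y` form a subgroup `M x y` of `G x × G y` with full projections, and Goursat's
lemma turns it into `φ x y`. The frame conditions reduce to three facts about atoms through base
points: `at₂ x x` is `x`, `at₂ y x` is the converse of `at₂ x y`, and `at₂ x z` lies below `at₂ x y
⨟ at₂ y z`.

Restricting the representation to the points `pt g` embeds `A` densely in the group relation
algebra, which is complete and so is the completion of `A`. Conversely, dense embeddings preserve
existing sums, and sums in a group relation algebra are unions. In the finite case all sums are
finite joins and the completion adds nothing. -/

theorem exists_mulEquiv_mk_eq_iff {G H : Type*} [Group G] [Group H] (M : Subgroup (G × H))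
    (h₁ : ∀ g, ∃ k, (g, k) ∈ M) (h₂ : ∀ k, ∃ g, (g, k) ∈ M)
    [M.goursatFst.Normal] [M.goursatSnd.Normal] :
    ∃ e : G ⧸ M.goursatFst ≃* H ⧸ M.goursatSnd, ∀ (g : G) (k : H),
      e (QuotientGroup.mk g) = QuotientGroup.mk k ↔ (g, k) ∈ M := by
  obtain ⟨e, he⟩ := goursat_surjective (I := M)
    (fun g => (h₁ g).elim fun k hk => ⟨⟨(g, k), hk⟩, rfl⟩)
    (fun k => (h₂ k).elim fun g hg => ⟨⟨(g, k), hg⟩, rfl⟩)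
  have key : ∀ g k, (g, k) ∈ M → e (QuotientGroup.mk g) = QuotientGroup.mk k := by
    intro g k h
    have : ((QuotientGroup.mk g : G ⧸ M.goursatFst), (QuotientGroup.mk k : H ⧸ M.goursatSnd)) ∈
        e.toMonoidHom.graph := by
      rw [← he]
      exact ⟨⟨(g, k), h⟩, rfl⟩
    exact this
  refine ⟨e, fun g k => ⟨fun h => ?_, key g k⟩⟩
  -- `M` contains `1 × goursatSnd`, so membership of `(g, k)` depends only on the coset of `k`.
  obtain ⟨k', hk'⟩ := h₁ g
  rw [key g k' hk', QuotientGroup.eq, mem_goursatSnd] at h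
  simpa using M.mul_mem hk' h

end Subgroup

namespace GroupPair

variable {I : Type u} {G : I → Type u} [∀ x, Group (G x)] {P : GroupPair I G}

/-- A group pair is a frame if its isomorphisms `φ x y` arise, as in Goursat's lemma, from subgroups
`M x y` of `G x × G y` that are coherent with respect to relational composition. -/
theorem isFrame_of_subgroups (M : ∀ x y, Subgroup (G x × G y))
    (hφ : ∀ x y (h : P.equiv x y) (g : G x) (k : G y),
      P.φ x y h (QuotientGroup.mk g) = QuotientGroup.mk k ↔ (g, k) ∈ M x y)
    (hself : ∀ x (g k : G x), (g, k) ∈ M x x ↔ g = k)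
    (hsymm : ∀ x y (g : G x) (k : G y), P.equiv x y → (g, k) ∈ M x y → (k, g) ∈ M y x)
    (hcomp : ∀ x y z (g : G x) (l : G z), P.equiv x y → P.equiv y z → (g, l) ∈ M x z →
      ∃ k : G y, (g, k) ∈ M x y ∧ (k, l) ∈ M y z) : P.IsFrame := by
  have hH : ∀ x y (_ : P.equiv x y) (g : G x), g ∈ P.H x y ↔ (g, 1) ∈ M x y := by
    intro x y h g
    rw [← hφ x y h, QuotientGroup.mk_one, map_eq_one_iff _ (P.φ x y h).injective,
      QuotientGroup.eq_one_iff]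
  have hK : ∀ x y (_ : P.equiv x y) (k : G y), k ∈ P.K x y ↔ (1, k) ∈ M x y := by
    intro x y h k
    rw [← hφ x y h, QuotientGroup.mk_one, map_one, eq_comm, QuotientGroup.eq_one_iff]
  have hsymm' : ∀ x y (g : G x) (k : G y), P.equiv x y → ((g, k) ∈ M x y ↔ (k, g) ∈ M y x) :=
    fun x y g k h => ⟨hsymm x y g k h, hsymm y x k g (P.equiv.symm h)⟩
  have him : ∀ x y (h : P.equiv x y) (X : Set (G x)) (k : G y),
      k ∈ P.image h X ↔ ∃ g ∈ X, (g, k) ∈ M x y := by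
    intro x y h X k
    simp only [image, Set.mem_ofPred_eq, hφ]
  refine ⟨?_, ?_, ?_, ?_, ?_, ?_, ?_, ?_⟩
  · intro x
    ext g
    rw [hH x x (P.equiv.refl x), hself, Subgroup.mem_bot]
  · intro x
    ext g
    rw [hK x x (P.equiv.refl x), hself, Subgroup.mem_bot, eq_comm]
  · intro x g
    rw [hφ, hself]
  · intro x y h
    ext k
    rw [hH y x (P.equiv.symm h), hK x y h, hsymm' x y _ _ h]
  · intro x y h
    ext g
    rw [hK y x (P.equiv.symm h), hH x y h, hsymm' x y _ _ h]
  · intro x y h g k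
    rw [hφ, hφ, hsymm' x y _ _ h]
  · intro x y z h h'
    have hxz := P.equiv.trans h h'
    ext k
    rw [him, Set.mem_mul]
    constructor
    · rintro ⟨_, ⟨a, ha, b, hb, rfl⟩, hk⟩
      have ha' := (hH x y h a).1 ha
      have hb' := (hH x z hxz b).1 hb
      -- Factoring `(b, 1)` through `y` produces the `H y z` part `m`; the rest, `(1, k * m⁻¹) = (a,
      -- 1)⁻¹ * (a * b, k) * (b, m)⁻¹`, lies in `M x y`.
      obtain ⟨m, hm, hm'⟩ := hcomp x y z b 1 h h' hb'
      refine ⟨k * m⁻¹, (hK x y h _).2 ?_, m, (hH y z h' m).2 hm', by simp⟩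
      have := mul_mem (mul_mem (inv_mem ha') hk) (inv_mem hm)
      simpa using this
    · rintro ⟨n, hn, m, hm, rfl⟩
      have hn' := (hK x y h n).1 hn
      have hm' := (hH y z h' m).1 hm
      obtain ⟨g, hg, hg'⟩ := hcomp y x z m 1 (P.equiv.symm h) hxz hm'
      refine ⟨g, ⟨1, one_mem _, g, (hH x z hxz g).2 hg', one_mul g⟩, ?_⟩
      have := mul_mem hn' (hsymm y x m g (P.equiv.symm h) hg)
      simpa using this
  · intro x y z h h' g
    have hxz := P.equiv.trans h h'
    ext l
    rw [him, him]
    constructor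
    · rintro ⟨k, hk, hkl⟩
      obtain ⟨g', hg', hg'k⟩ := (him x y h _ k).1 hk
      -- `g''` may differ from `g'`, but both are paired with `k`, so they agree modulo `H x y` and
      -- lie in the same coset of `H x y * H x z`.
      obtain ⟨g'', h1, h2⟩ := hcomp y x z k l (P.equiv.symm h) hxz hkl
      refine ⟨g'', ?_, h2⟩
      have h3 : g'⁻¹ * g'' ∈ P.H x y := (hH x y h _).2 <| by
        simpa using mul_mem (inv_mem hg'k) (hsymm y x k g'' (P.equiv.symm h) h1)
      rw [Set.mem_smul_set_iff_inv_smul_mem, ← Subgroup.mul_normal, SetLike.mem_coe,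
        smul_eq_mul] at hg' ⊢
      simpa [mul_assoc] using mul_mem hg' (Subgroup.mem_sup_left h3)
    · rintro ⟨g', hg', hl⟩
      obtain ⟨k, hk, hkl⟩ := hcomp x y z g' l h h' hl
      exact ⟨k, (him x y h _ k).2 ⟨g', hg', hk⟩, hkl⟩

theorem exists_isFrame_of_subgroups (s : Setoid I) (M : ∀ x y, Subgroup (G x × G y))
    (h₁ : ∀ x y (g : G x), ∃ k, (g, k) ∈ M x y) (h₂ : ∀ x y (k : G y), ∃ g, (g, k) ∈ M x y)
    (hself : ∀ x (g k : G x), (g, k) ∈ M x x ↔ g = k)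
    (hsymm : ∀ x y (g : G x) (k : G y), s x y → (g, k) ∈ M x y → (k, g) ∈ M y x)
    (hcomp : ∀ x y z (g : G x) (l : G z), s x y → s y z → (g, l) ∈ M x z →
      ∃ k : G y, (g, k) ∈ M x y ∧ (k, l) ∈ M y z) :
    ∃ P : GroupPair I G, P.IsFrame ∧ P.equiv = s ∧ ∀ x y (h : P.equiv x y) (g : G x) (k : G y),
      P.φ x y h (QuotientGroup.mk g) = QuotientGroup.mk k ↔ (g, k) ∈ M x y := by
  have n₁ : ∀ x y, (M x y).goursatFst.Normal := fun x y =>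
    Subgroup.normal_goursatFst fun g => (h₁ x y g).elim fun k hk => ⟨⟨(g, k), hk⟩, rfl⟩
  have n₂ : ∀ x y, (M x y).goursatSnd.Normal := fun x y =>
    Subgroup.normal_goursatSnd fun k => (h₂ x y k).elim fun g hg => ⟨⟨(g, k), hg⟩, rfl⟩
  choose e he using fun x y => (M x y).exists_mulEquiv_mk_eq_iff (h₁ x y) (h₂ x y)
  let P : GroupPair I G := ⟨s, fun x y => (M x y).goursatFst, fun x y => (M x y).goursatSnd,
    n₁, n₂, fun x y _ => e x y⟩
  exact ⟨P, isFrame_of_subgroups M (fun x y _ => he x y) hself hsymm hcomp, rfl,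
    fun x y _ => he x y⟩

end GroupPair

/-! ### Complete representations, point by point -/

namespace RelationAlgebra

variable {A U : Type u} [RelationAlgebra A]

/-- A complete representation of `A` by binary relations `T a` on `U`. -/
structure CompleteRep (A U : Type u) [RelationAlgebra A] where
  T : A → U → U → Prop
  T_sup : ∀ a b p q, T (a ⊔ b) p q ↔ T a p q ∨ T b p q
  T_compl : ∀ a p q, T aᶜ p q ↔ T ⊤ p q ∧ ¬ T a p q
  T_rmul : ∀ a b p q, T (a ⨟ b) p q ↔ ∃ r, T a p r ∧ T b r q
  T_conv : ∀ a p q, T (conv a) p q ↔ T a q p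
  T_ident : ∀ p q, T ident p q ↔ p = q
  le_of_T : ∀ a b, (∀ p q, T a p q → T b p q) → a ≤ b
  exists_of_isLUB : ∀ X a p q, IsLUB X a → T a p q → ∃ b ∈ X, T b p q

theorem CompletelyRepresentable.exists_completeRep (h : CompletelyRepresentable A) :
    ∃ U : Type u, Nonempty (CompleteRep A U) := by
  obtain ⟨U, S, θ, ⟨hθ, hbij⟩, hlub⟩ := h
  have hsup : ∀ a b p, p ∈ (θ (a ⊔ b)).rel ↔ p ∈ (θ a).rel ∨ p ∈ (θ b).rel := by
    intro a b p
    rw [hθ.map_sup]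
    rfl
  have hcompl : ∀ a p, p ∈ (θ aᶜ).rel ↔ S.E p.1 p.2 ∧ p ∉ (θ a).rel := by
    intro a p
    rw [hθ.map_compl]
    rfl
  have htop : ∀ p, p ∈ (θ ⊤).rel ↔ S.E p.1 p.2 := by
    intro p
    rw [← sup_compl_eq_top (x := (⊤ : A)), hsup, hcompl]
    have := (θ ⊤).related (p := p)
    tauto
  refine ⟨U, ⟨⟨fun a p q => (p, q) ∈ (θ a).rel, fun a b p q => hsup a b _, ?_, ?_, ?_, ?_, ?_, ?_⟩⟩⟩
  · intro a p q
    rw [hcompl, htop]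
  · intro a b p q
    rw [hθ.map_rmul]
    rfl
  · intro a p q
    rw [hθ.map_conv]
    rfl
  · intro p q
    rw [hθ.map_ident]
    rfl
  · intro a b hab
    rw [← sup_eq_right]
    apply hbij.1
    apply SetRelationAlgebra.Elem.ext
    intro p
    rw [hsup]
    exact ⟨fun h => h.elim (hab p.1 p.2) id, Or.inr⟩
  · intro X a p q hX hp
    rw [hlub X a hX] at hp
    simpa using hp

namespace CompleteRep

variable (ρ : CompleteRep A U)

theorem T_mono {a b : A} (h : a ≤ b) {p q : U} (hp : ρ.T a p q) : ρ.T b p q := by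
  rw [← sup_eq_right.2 h, ρ.T_sup]
  exact Or.inl hp

theorem T_top {a : A} {p q : U} (hp : ρ.T a p q) : ρ.T ⊤ p q := ρ.T_mono le_top hp

theorem not_T_bot (p q : U) : ¬ ρ.T ⊥ p q := by
  rw [← compl_top, ρ.T_compl]
  tauto

theorem T_inf (a b : A) (p q : U) : ρ.T (a ⊓ b) p q ↔ ρ.T a p q ∧ ρ.T b p q := by
  rw [← compl_compl (a ⊓ b), compl_inf, ρ.T_compl, ρ.T_sup, ρ.T_compl, ρ.T_compl]
  have h1 := ρ.T_top (a := a) (p := p) (q := q)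
  tauto

theorem ext_of_T {a b : A} (h : ∀ p q, ρ.T a p q ↔ ρ.T b p q) : a = b :=
  le_antisymm (ρ.le_of_T a b fun p q => (h p q).1) (ρ.le_of_T b a fun p q => (h p q).2)

theorem exists_T {a : A} (h : a ≠ ⊥) : ∃ p q, ρ.T a p q := by
  by_contra! h'
  exact h (le_bot_iff.1 (ρ.le_of_T _ _ fun p q hp => (h' p q hp).elim))

theorem T_top_refl (p : U) : ρ.T ⊤ p p := ρ.T_top ((ρ.T_ident p p).2 rfl)

theorem T_top_symm {p q : U} (h : ρ.T ⊤ p q) : ρ.T ⊤ q p := ρ.T_top ((ρ.T_conv _ _ _).2 h)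

theorem T_top_trans {p q r : U} (h : ρ.T ⊤ p q) (h' : ρ.T ⊤ q r) : ρ.T ⊤ p r :=
  ρ.T_top ((ρ.T_rmul _ _ _ _).2 ⟨q, h, h'⟩)

theorem le_of_isAtom {a b : A} (ha : IsAtom a) {p q : U} (h : ρ.T a p q) (h' : ρ.T b p q) :
    a ≤ b := by
  rcases ha.le_iff.1 (inf_le_left : a ⊓ b ≤ a) with h0 | h0
  · exact (ρ.not_T_bot p q (h0 ▸ (ρ.T_inf a b p q).2 ⟨h, h'⟩)).elim
  · exact inf_eq_left.1 h0

theorem eq_of_isAtom {a b : A} (ha : IsAtom a) (hb : IsAtom b) {p q : U} (h : ρ.T a p q)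
    (h' : ρ.T b p q) : a = b :=
  le_antisymm (ρ.le_of_isAtom ha h h') (ρ.le_of_isAtom hb h' h)

/-- A completely representable algebra is atomic, pointwise. -/
theorem exists_isAtom {p q : U} (h : ρ.T ⊤ p q) : ∃ a, IsAtom a ∧ ρ.T a p q := by
  by_contra! hno
  -- If no atom contains `(p, q)`, the elements missing it already have sum `⊤`, although their
  -- union misses `(p, q)`.
  have hlub : IsLUB {a : A | ¬ ρ.T a p q} ⊤ := by
    refine ⟨fun _ _ => le_top, fun b hb => ?_⟩
    have hle : ∀ a, ρ.T a p q → bᶜ ≤ a := by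
      intro a ha
      rw [compl_le_iff_compl_le]
      exact hb fun h' => ((ρ.T_compl a p q).1 h').2 ha
    rw [top_le_iff, ← compl_eq_bot]
    by_contra hc
    -- `bᶜ` lies below every element containing `(p, q)`. If it contains the pair itself, it is an
    -- atom; if not, then `bᶜ ≤ b`.
    by_cases hcT : ρ.T bᶜ p q
    · apply hno bᶜ ⟨hc, fun d hd => ?_⟩ hcT
      have hdT : ¬ ρ.T d p q := fun h' => hd.not_ge (hle d h')
      have := hle dᶜ ((ρ.T_compl d p q).2 ⟨h, hdT⟩)
      exact le_compl_self.1 (hd.le.trans this)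
    · exact hc (by simpa using hb hcT)
  obtain ⟨b, hb, hb'⟩ := ρ.exists_of_isLUB _ _ p q hlub h
  exact hb hb'

section Subidentity

variable {ρ} {x y : A}

theorem eq_of_T (hx : x ≤ ident) {p q : U} (h : ρ.T x p q) : p = q :=
  (ρ.T_ident p q).1 (ρ.T_mono hx h)

theorem T_iff (hx : x ≤ ident) {p q : U} : ρ.T x p q ↔ ρ.T x p p ∧ p = q := by
  constructor
  · intro h
    obtain rfl := eq_of_T hx h
    exact ⟨h, rfl⟩
  · rintro ⟨h, rfl⟩
    exact h

theorem T_sandwich (hx : x ≤ ident) (hy : y ≤ ident) {a : A} {p q : U} :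
    ρ.T (x ⨟ a ⨟ y) p q ↔ ρ.T x p p ∧ ρ.T a p q ∧ ρ.T y q q := by
  simp only [ρ.T_rmul]
  constructor
  · rintro ⟨r, ⟨s, h1, h2⟩, h3⟩
    obtain rfl := eq_of_T hx h1
    obtain rfl := eq_of_T hy h3
    exact ⟨h1, h2, h3⟩
  · rintro ⟨h1, h2, h3⟩
    exact ⟨q, ⟨p, h1, h2⟩, h3⟩

/-- Uniformity of atoms: `b ⨟ conv b` contains `(p, p)`, hence lies above the atom `x`, so every
point of `x` is in the domain of `b`. -/
theorem exists_T_of_isAtom (hx : IsAtom x) {b : A} {p r p' : U} (hp : ρ.T x p p)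
    (hb : ρ.T b p r) (hp' : ρ.T x p' p') : ∃ r', ρ.T b p' r' := by
  have := ρ.T_mono (ρ.le_of_isAtom hx hp
    ((ρ.T_rmul b (conv b) p p).2 ⟨r, hb, (ρ.T_conv _ _ _).2 hb⟩)) hp'
  obtain ⟨r', h, -⟩ := (ρ.T_rmul _ _ _ _).1 this
  exact ⟨r', h⟩

theorem exists_T_top_of_isAtom (hx : IsAtom x) (hy : y ≤ ident) {p q p' : U}
    (hp : ρ.T x p p) (hq : ρ.T y q q) (hpq : ρ.T ⊤ p q) (hp' : ρ.T x p' p') :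
    ∃ q', ρ.T y q' q' ∧ ρ.T ⊤ p' q' := by
  obtain ⟨r, hr⟩ := exists_T_of_isAtom hx hp ((ρ.T_rmul ⊤ y p q).2 ⟨q, hpq, hq⟩) hp'
  obtain ⟨s, h1, h2⟩ := (ρ.T_rmul _ _ _ _).1 hr
  obtain rfl := eq_of_T hy h2
  exact ⟨s, h2, h1⟩

end Subidentity

/-! ### Permutations of the points of a measurable atom -/

/-- `f` acts as a permutation of the set of points of the subidentity element `x`. -/
structure IsPerm (x f : A) : Prop where
  left : ∀ {p q}, ρ.T f p q → ρ.T x p p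
  right : ∀ {p q}, ρ.T f p q → ρ.T x q q
  total : ∀ {p}, ρ.T x p p → ∃ q, ρ.T f p q
  surj : ∀ {q}, ρ.T x q q → ∃ p, ρ.T f p q
  func : ∀ {p q r}, ρ.T f p q → ρ.T f p r → q = r
  inj : ∀ {p q r}, ρ.T f p r → ρ.T f q r → p = q

variable {ρ}

theorem isPerm_self {x : A} (hx : x ≤ ident) : ρ.IsPerm x x where
  left h := ((T_iff hx).1 h).1
  right h := (eq_of_T hx h) ▸ ((T_iff hx).1 h).1
  total h := ⟨_, h⟩
  surj h := ⟨_, h⟩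
  func h h' := (eq_of_T hx h).symm.trans (eq_of_T hx h')
  inj h h' := (eq_of_T hx h).trans (eq_of_T hx h').symm

theorem IsPerm.conv {x f : A} (h : ρ.IsPerm x f) : ρ.IsPerm x (conv f) where
  left h' := h.right ((ρ.T_conv _ _ _).1 h')
  right h' := h.left ((ρ.T_conv _ _ _).1 h')
  total h' := (h.surj h').imp fun _ => (ρ.T_conv _ _ _).2
  surj h' := (h.total h').imp fun _ => (ρ.T_conv _ _ _).2
  func h1 h2 := h.inj ((ρ.T_conv _ _ _).1 h1) ((ρ.T_conv _ _ _).1 h2)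
  inj h1 h2 := h.func ((ρ.T_conv _ _ _).1 h1) ((ρ.T_conv _ _ _).1 h2)

theorem IsPerm.rmul {x f g : A} (hf : ρ.IsPerm x f) (hg : ρ.IsPerm x g) :
    ρ.IsPerm x (f ⨟ g) where
  left h := by
    obtain ⟨r, h1, h2⟩ := (ρ.T_rmul _ _ _ _).1 h
    exact hf.left h1
  right h := by
    obtain ⟨r, h1, h2⟩ := (ρ.T_rmul _ _ _ _).1 h
    exact hg.right h2
  total h := by
    obtain ⟨r, h1⟩ := hf.total h
    obtain ⟨s, h2⟩ := hg.total (hf.right h1)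
    exact ⟨s, (ρ.T_rmul _ _ _ _).2 ⟨r, h1, h2⟩⟩
  surj h := by
    obtain ⟨r, h1⟩ := hg.surj h
    obtain ⟨s, h2⟩ := hf.surj (hg.left h1)
    exact ⟨s, (ρ.T_rmul _ _ _ _).2 ⟨r, h2, h1⟩⟩
  func h h' := by
    obtain ⟨r, h1, h2⟩ := (ρ.T_rmul _ _ _ _).1 h
    obtain ⟨s, h3, h4⟩ := (ρ.T_rmul _ _ _ _).1 h'
    obtain rfl := hf.func h1 h3
    exact hg.func h2 h4
  inj h h' := by
    obtain ⟨r, h1, h2⟩ := (ρ.T_rmul _ _ _ _).1 h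
    obtain ⟨s, h3, h4⟩ := (ρ.T_rmul _ _ _ _).1 h'
    obtain rfl := hg.inj h2 h4
    exact hf.inj h1 h3

theorem IsPerm.conv_rmul_self {x f : A} (hx : x ≤ ident) (hf : ρ.IsPerm x f) :
    RelationAlgebra.conv f ⨟ f = x := by
  apply ρ.ext_of_T
  intro p q
  rw [ρ.T_rmul]
  constructor
  · rintro ⟨r, h1, h2⟩
    rw [ρ.T_conv] at h1
    obtain rfl := hf.func h1 h2
    exact hf.right h1
  · intro h
    obtain rfl := eq_of_T hx h
    obtain ⟨r, hr⟩ := hf.surj h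
    exact ⟨r, (ρ.T_conv _ _ _).2 hr, hr⟩

theorem self_rmul {x f : A} (hx : x ≤ ident) (hf : ∀ p q, ρ.T f p q → ρ.T x p p) :
    x ⨟ f = f := by
  apply ρ.ext_of_T
  intro p q
  rw [ρ.T_rmul]
  constructor
  · rintro ⟨r, h1, h2⟩
    obtain rfl := eq_of_T hx h1
    exact h2
  · exact fun h => ⟨p, hf p q h, h⟩

theorem rmul_self {x f : A} (hx : x ≤ ident) (hf : ∀ p q, ρ.T f p q → ρ.T x q q) :
    f ⨟ x = f := by
  apply ρ.ext_of_T
  intro p q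
  rw [ρ.T_rmul]
  constructor
  · rintro ⟨r, h1, h2⟩
    obtain rfl := eq_of_T hx h2
    exact h1
  · exact fun h => ⟨q, h, hf p q h⟩

/-- By uniformity `f ⊓ g`, being defined at one point of `x`, is defined at all, and `f` is
single-valued. This makes the action on points free. -/
theorem IsPerm.le_of_T {x f g : A} (hx : IsAtom x) (hf : ρ.IsPerm x f) {p q : U}
    (h : ρ.T f p q) (h' : ρ.T g p q) : f ≤ g := by
  refine ρ.le_of_T _ _ fun r s hrs => ?_
  obtain ⟨t, ht⟩ := exists_T_of_isAtom hx (hf.left h) ((ρ.T_inf f g p q).2 ⟨h, h'⟩) (hf.left hrs)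
  rw [ρ.T_inf] at ht
  obtain rfl := hf.func hrs ht.1
  exact ht.2

theorem IsPerm.eq_of_T {x f g : A} (hx : IsAtom x) (hf : ρ.IsPerm x f) (hg : ρ.IsPerm x g)
    {p q : U} (h : ρ.T f p q) (h' : ρ.T g p q) : f = g :=
  le_antisymm (hf.le_of_T hx h h') (hg.le_of_T hx h' h)

theorem func_of_isFunctional {f : A} (hf : IsFunctional f) {p q r : U} (h : ρ.T f p q)
    (h' : ρ.T f p r) : q = r :=
  CompleteRep.eq_of_T hf ((ρ.T_rmul _ _ _ _).2 ⟨p, (ρ.T_conv _ _ _).2 h, h'⟩)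

/-- Composition with a permutation is undone by its converse: a nonzero `b` below `a ⨟ f` gives `a ≤
b ⨟ conv f`, whence `a ⨟ f ≤ b`. -/
theorem isAtom_rmul {x f a : A} (hf : ρ.IsPerm x f) (ha : IsAtom a)
    (hax : ∀ p q, ρ.T a p q → ρ.T x q q) : IsAtom (a ⨟ f) := by
  refine ⟨fun h0 => ?_, fun b hb => ?_⟩
  · obtain ⟨p, q, hpq⟩ := ρ.exists_T ha.1
    obtain ⟨r, hr⟩ := hf.total (hax p q hpq)
    exact ρ.not_T_bot p r (h0 ▸ (ρ.T_rmul _ _ _ _).2 ⟨q, hpq, hr⟩)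
  · by_contra hne
    obtain ⟨p, r, hpr⟩ := ρ.exists_T hne
    obtain ⟨s, h1, h2⟩ := (ρ.T_rmul _ _ _ _).1 (ρ.T_mono hb.le hpr)
    have hle : a ≤ b ⨟ conv f := ρ.le_of_isAtom ha h1
      ((ρ.T_rmul _ _ _ _).2 ⟨r, hpr, (ρ.T_conv _ _ _).2 h2⟩)
    refine hb.not_ge (ρ.le_of_T _ _ fun p q hpq => ?_)
    obtain ⟨t, h3, h4⟩ := (ρ.T_rmul _ _ _ _).1 hpq
    obtain ⟨t', h5, h6⟩ := (ρ.T_rmul _ _ _ _).1 (ρ.T_mono hle h3)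
    rwa [hf.func h4 ((ρ.T_conv _ _ _).1 h6)]

variable (ρ) in
include ρ in
theorem isAtom_conv {a : A} (ha : IsAtom a) : IsAtom (conv a) := by
  refine ⟨fun h0 => ?_, fun b hb => ?_⟩
  · obtain ⟨p, q, hpq⟩ := ρ.exists_T ha.1
    exact ρ.not_T_bot q p (h0 ▸ (ρ.T_conv _ _ _).2 hpq)
  · by_contra hne
    obtain ⟨p, q, hpq⟩ := ρ.exists_T hne
    have hle : a ≤ conv b := ρ.le_of_isAtom ha ((ρ.T_conv _ _ _).1 (ρ.T_mono hb.le hpq))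
      ((ρ.T_conv _ _ _).2 hpq)
    exact hb.not_ge (ρ.le_of_T _ _ fun p q h =>
      (ρ.T_conv _ _ _).1 (ρ.T_mono hle ((ρ.T_conv _ _ _).1 h)))

theorem rmul_isAtom {x f a : A} (hf : ρ.IsPerm x f) (ha : IsAtom a)
    (hax : ∀ p q, ρ.T a p q → ρ.T x p p) : IsAtom (f ⨟ a) := by
  have := isAtom_conv ρ (isAtom_rmul hf.conv (isAtom_conv ρ ha)
    fun p q h => hax q p ((ρ.T_conv _ _ _).1 h))
  rwa [conv_rmul, conv_conv, conv_conv] at this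

/-- The permutations of the points of a measurable atom act transitively on related points. -/
theorem exists_isPerm {x : A} (hx : IsMeasurableAtom x) {p q : U} (hp : ρ.T x p p)
    (hq : ρ.T x q q) (hpq : ρ.T ⊤ p q) : ∃ f, ρ.IsPerm x f ∧ ρ.T f p q := by
  obtain ⟨hat, hid, F, hF, hlub⟩ := hx
  have hle : ∀ f ∈ F, ∀ {p q}, ρ.T f p q → ρ.T x p p ∧ ρ.T x q q := fun f hf p q h =>
    have := (T_sandwich hid hid).1 (ρ.T_mono (hlub.1 hf) h)
    ⟨this.1, this.2.2⟩
  obtain ⟨f, hf, hfT⟩ := ρ.exists_of_isLUB _ _ p q hlub ((T_sandwich hid hid).2 ⟨hp, hpq, hq⟩)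
  obtain ⟨g, hg, hgT⟩ := ρ.exists_of_isLUB _ _ q p hlub
    ((T_sandwich hid hid).2 ⟨hq, ρ.T_top_symm hpq, hp⟩)
  refine ⟨f, ⟨fun h => (hle f hf h).1, fun h => (hle f hf h).2,
    exists_T_of_isAtom hat hp hfT, fun {s} hs => ?_, func_of_isFunctional (hF f hf), ?_⟩, hfT⟩
  · obtain ⟨r, hr⟩ := exists_T_of_isAtom hat hq ((ρ.T_conv f q p).2 hfT) hs
    exact ⟨r, (ρ.T_conv _ _ _).1 hr⟩
  -- Since `f ⨟ g` contains `(p, p)`, it lies above `x`, so `g` undoes `f` everywhere; injectivity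
  -- of `f` is then functionality of `g`.
  · have key : ∀ {s r}, ρ.T f s r → ρ.T g r s := by
      intro s r h
      have := ρ.T_mono (ρ.le_of_isAtom hat hp ((ρ.T_rmul f g p p).2 ⟨q, hfT, hgT⟩)) (hle f hf h).1
      obtain ⟨t, h1, h2⟩ := (ρ.T_rmul _ _ _ _).1 this
      obtain rfl := func_of_isFunctional (hF f hf) h h1
      exact h2
    intro _ _ _ h h'
    exact func_of_isFunctional (hF g hg) (key h) (key h')

end CompleteRep

/-- The type of measurable atoms. -/
abbrev MeasurableAtom (A : Type u) [RelationAlgebra A] : Type u := {x : A // IsMeasurableAtom x}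

namespace CompleteRep

variable (ρ : CompleteRep A U)

/-- The group of elements acting as permutations of the points of a measurable atom. -/
abbrev PermGroup (x : MeasurableAtom A) : Type u := {f : A // ρ.IsPerm x.1 f}

variable {ρ}

instance (x : MeasurableAtom A) : Group (ρ.PermGroup x) where
  mul f g := ⟨f.1 ⨟ g.1, f.2.rmul g.2⟩
  one := ⟨x.1, isPerm_self x.2.2.1⟩
  inv f := ⟨conv f.1, f.2.conv⟩
  mul_assoc f g h := Subtype.ext (rmul_assoc f.1 g.1 h.1).symm
  one_mul f := Subtype.ext (self_rmul x.2.2.1 fun _ _ => f.2.left)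
  mul_one f := Subtype.ext (rmul_self x.2.2.1 fun _ _ => f.2.right)
  inv_mul_cancel f := Subtype.ext (f.2.conv_rmul_self x.2.2.1)

theorem PermGroup.val_one {x : MeasurableAtom A} : (1 : ρ.PermGroup x).1 = x.1 := rfl

theorem exists_measurableAtom (hA : IsMeasurableAlgebra A) (p : U) :
    ∃ x : MeasurableAtom A, ρ.T x.1 p p := by
  obtain ⟨X, hX, hlub⟩ := hA
  obtain ⟨x, hx, hp⟩ := ρ.exists_of_isLUB _ _ p p hlub ((ρ.T_ident p p).2 rfl)
  exact ⟨⟨x, hX x hx⟩, hp⟩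

variable (ρ) in
-- Call two atoms equivalent if some of their points are related. Fix a point of one representative
-- per class; uniformity gives every atom of the class a point related to it.
theorem exists_base : ∃ b : MeasurableAtom A → U, (∀ x, ρ.T x.1 (b x) (b x)) ∧
    ∀ x y p q, ρ.T x.1 p p → ρ.T y.1 q q → ρ.T ⊤ p q → ρ.T ⊤ (b x) (b y) := by
  have hne : ∀ x : MeasurableAtom A, ∃ p, ρ.T x.1 p p := fun x => by
    obtain ⟨p, q, h⟩ := ρ.exists_T x.2.1.1
    exact ⟨p, ((T_iff x.2.2.1).1 h).1⟩
  have hstep : ∀ {x y : MeasurableAtom A} {p q p' : U}, ρ.T x.1 p p → ρ.T y.1 q q → ρ.T ⊤ p q →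
      ρ.T x.1 p' p' → ∃ q', ρ.T y.1 q' q' ∧ ρ.T ⊤ p' q' := fun {x y _ _ _} =>
    exists_T_top_of_isAtom x.2.1 y.2.2.1
  let s : Setoid (MeasurableAtom A) :=
    { r := fun x y => ∃ p q, ρ.T x.1 p p ∧ ρ.T y.1 q q ∧ ρ.T ⊤ p q
      iseqv :=
        { refl := fun x => (hne x).imp fun p hp => ⟨p, hp, hp, ρ.T_top_refl p⟩
          symm := fun ⟨p, q, h1, h2, h3⟩ => ⟨q, p, h2, h1, ρ.T_top_symm h3⟩
          trans := fun ⟨p, q, h1, h2, h3⟩ ⟨p', q', h1', h2', h3'⟩ => by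
            obtain ⟨r, hr, hr'⟩ := hstep h1' h2' h3' h2
            exact ⟨p, r, h1, hr, ρ.T_top_trans h3 hr'⟩ } }
  have hne' := hne
  choose c hc using hne'
  have hb : ∀ x : MeasurableAtom A, ∃ q, ρ.T x.1 q q ∧
      ρ.T ⊤ (c (Quotient.mk s x).out) q := fun x => by
    obtain ⟨p, q, h1, h2, h3⟩ : s.r (Quotient.mk s x).out x := Quotient.mk_out x
    exact hstep h1 h2 h3 (hc _)
  choose b hb hb' using hb
  refine ⟨b, hb, fun x y p q hp hq hpq => ?_⟩
  have hxy : Quotient.mk s x = Quotient.mk s y := Quotient.sound ⟨p, q, hp, hq, hpq⟩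
  exact ρ.T_top_trans (ρ.T_top_symm (hb' x)) (hxy ▸ hb' y)

end CompleteRep

end RelationAlgebra

/-! ### The frame of a based representation -/

namespace RelationAlgebra

variable {A U : Type u} [RelationAlgebra A]

/-- A complete representation with a choice of base points of the measurable atoms. -/
structure BasedRep (A U : Type u) [RelationAlgebra A] extends CompleteRep A U where
  base : MeasurableAtom A → U
  T_base : ∀ x, T x.1 (base x) (base x)
  T_top_base : ∀ x y p q, T x.1 p p → T y.1 q q → T ⊤ p q → T ⊤ (base x) (base y)
  exists_atom : ∀ p, ∃ x : MeasurableAtom A, T x.1 p p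

namespace BasedRep

open CompleteRep

variable (ρ : BasedRep A U)

abbrev G (x : MeasurableAtom A) : Type u := ρ.PermGroup x

variable {x y z : MeasurableAtom A}

/-- The point to which the base point of `x` is moved by `g`. -/
noncomputable def pt {x : MeasurableAtom A} (g : ρ.G x) : U := (g.2.total (ρ.T_base x)).choose

theorem T_pt (g : ρ.G x) : ρ.T g.1 (ρ.base x) (ρ.pt g) := (g.2.total (ρ.T_base x)).choose_spec

theorem T_pt_self (g : ρ.G x) : ρ.T x.1 (ρ.pt g) (ρ.pt g) := g.2.right (ρ.T_pt g)

theorem T_pt_mul (g h : ρ.G x) : ρ.T h.1 (ρ.pt g) (ρ.pt (g * h)) := by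
  obtain ⟨r, h1, h2⟩ := (ρ.T_rmul _ _ _ _).1 (ρ.T_pt (g * h))
  rwa [← g.2.func h1 (ρ.T_pt g)]

theorem pt_one : ρ.pt (1 : ρ.G x) = ρ.base x := (CompleteRep.eq_of_T x.2.2.1 (ρ.T_pt 1)).symm

/-- Under `pt` the action on points becomes right translation; freeness upgrades agreement at the
base point to equality. -/
theorem T_pt_iff (g h k : ρ.G x) : ρ.T h.1 (ρ.pt g) (ρ.pt k) ↔ g * h = k := by
  constructor
  · intro h'
    refine Subtype.ext ((g * h).2.eq_of_T x.2.1 k.2 (ρ.T_pt (g * h)) ?_)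
    rw [h.2.func (ρ.T_pt_mul g h) h']
    exact ρ.T_pt k
  · rintro rfl
    exact ρ.T_pt_mul g h

theorem pt_injective {g k : ρ.G x} (h : ρ.pt g = ρ.pt k) : g = k := by
  rw [← mul_one g, ← T_pt_iff, ← h]
  exact ρ.T_pt_self g

theorem exists_pt {p : U} (hp : ρ.T x.1 p p) (h : ρ.T ⊤ (ρ.base x) p) :
    ∃ g : ρ.G x, ρ.pt g = p := by
  obtain ⟨f, hf, hfT⟩ := exists_isPerm x.2 (ρ.T_base x) hp h
  exact ⟨⟨f, hf⟩, hf.func (ρ.T_pt ⟨f, hf⟩) hfT⟩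

theorem T_top_base_pt (g : ρ.G x) : ρ.T ⊤ (ρ.base x) (ρ.pt g) := ρ.T_top (ρ.T_pt g)

theorem T_top_pt_iff (g : ρ.G x) (k : ρ.G y) :
    ρ.T ⊤ (ρ.pt g) (ρ.pt k) ↔ ρ.T ⊤ (ρ.base x) (ρ.base y) :=
  ⟨ρ.T_top_base x y _ _ (ρ.T_pt_self g) (ρ.T_pt_self k), fun h =>
    ρ.T_top_trans (ρ.T_top_symm (ρ.T_top_base_pt g)) (ρ.T_top_trans h (ρ.T_top_base_pt k))⟩

/-- The points `pt g` form a union of classes of the unit, so restriction to them preserves relative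
multiplication. -/
theorem exists_pt_of_T {p q : U} {g : ρ.G x} {a : A} (hp : ρ.pt g = p) (h : ρ.T a p q) :
    ∃ (y : MeasurableAtom A) (k : ρ.G y), ρ.pt k = q := by
  obtain ⟨y, hy⟩ := ρ.exists_atom q
  refine ⟨y, ρ.exists_pt hy ?_⟩
  subst hp
  exact ρ.T_top_trans (ρ.T_top_symm (ρ.T_top_base x y _ _ (ρ.T_pt_self g) hy (ρ.T_top h)))
    (ρ.T_top_trans (ρ.T_top_base_pt g) (ρ.T_top h))

/-- Measurable atoms whose base points are related. -/
def setoid : Setoid (MeasurableAtom A) where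
  r x y := ρ.T ⊤ (ρ.base x) (ρ.base y)
  iseqv := ⟨fun _ => ρ.T_top_refl _, ρ.T_top_symm, ρ.T_top_trans⟩

open Classical in
/-- The atom that relates the base points of `x` and `y`, if there is one. -/
noncomputable def at₂ (x y : MeasurableAtom A) : A :=
  if h : ρ.setoid x y then (ρ.exists_isAtom h).choose else ⊥

theorem isAtom_at₂ (h : ρ.setoid x y) : IsAtom (ρ.at₂ x y) := by
  rw [at₂, dif_pos h]
  exact (ρ.exists_isAtom h).choose_spec.1

theorem T_at₂ (h : ρ.setoid x y) : ρ.T (ρ.at₂ x y) (ρ.base x) (ρ.base y) := by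
  rw [at₂, dif_pos h]
  exact (ρ.exists_isAtom h).choose_spec.2

theorem T_of_T_at₂ {p q : U} (h : ρ.T (ρ.at₂ x y) p q) : ρ.T x.1 p p ∧ ρ.T y.1 q q := by
  by_cases hxy : ρ.setoid x y
  · have := ρ.T_mono (ρ.le_of_isAtom (ρ.isAtom_at₂ hxy) (ρ.T_at₂ hxy)
      ((T_sandwich (a := ⊤) x.2.2.1 y.2.2.1).2 ⟨ρ.T_base x, hxy, ρ.T_base y⟩)) h
    rw [T_sandwich x.2.2.1 y.2.2.1] at this
    exact ⟨this.1, this.2.2⟩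
  · rw [at₂, dif_neg hxy] at h
    exact (ρ.not_T_bot _ _ h).elim

theorem self_rmul_at₂ : x.1 ⨟ ρ.at₂ x y = ρ.at₂ x y :=
  self_rmul x.2.2.1 fun _ _ h => (ρ.T_of_T_at₂ h).1

theorem at₂_rmul_self : ρ.at₂ x y ⨟ y.1 = ρ.at₂ x y :=
  rmul_self y.2.2.1 fun _ _ h => (ρ.T_of_T_at₂ h).2

theorem at₂_rmul_mul (g h : ρ.G y) : ρ.at₂ x y ⨟ (g * h).1 = ρ.at₂ x y ⨟ g.1 ⨟ h.1 :=
  rmul_assoc _ _ _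

theorem mul_rmul_at₂ (g h : ρ.G x) : (g * h).1 ⨟ ρ.at₂ x y = g.1 ⨟ (h.1 ⨟ ρ.at₂ x y) :=
  (rmul_assoc _ _ _).symm

/-- The pairs of group elements whose actions on the atom `at₂ x y` agree. -/
noncomputable def M (x y : MeasurableAtom A) : Subgroup (ρ.G x × ρ.G y) where
  carrier := {p | p.1.1 ⨟ ρ.at₂ x y = ρ.at₂ x y ⨟ p.2.1}
  one_mem' := ρ.self_rmul_at₂.trans ρ.at₂_rmul_self.symm
  mul_mem' := by
    rintro ⟨g, k⟩ ⟨g', k'⟩ h h'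
    simp only [Set.mem_ofPred_eq] at h h'
    simp only [Set.mem_ofPred_eq, Prod.mk_mul_mk]
    rw [mul_rmul_at₂, h', rmul_assoc, h, at₂_rmul_mul]
  inv_mem' := by
    rintro ⟨g, k⟩ h
    simp only [Set.mem_ofPred_eq] at h
    simp only [Set.mem_ofPred_eq, Prod.inv_mk]
    calc (g⁻¹).1 ⨟ ρ.at₂ x y = (g⁻¹).1 ⨟ (ρ.at₂ x y ⨟ (k * k⁻¹).1) := by
          rw [mul_inv_cancel, PermGroup.val_one, at₂_rmul_self]
      _ = (g⁻¹).1 ⨟ (g.1 ⨟ ρ.at₂ x y) ⨟ (k⁻¹).1 := by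
          rw [at₂_rmul_mul, ← h, rmul_assoc]
      _ = _ := by
          rw [← mul_rmul_at₂, inv_mul_cancel, PermGroup.val_one, self_rmul_at₂]

theorem mem_M {g : ρ.G x} {k : ρ.G y} :
    (g, k) ∈ ρ.M x y ↔ g.1 ⨟ ρ.at₂ x y = ρ.at₂ x y ⨟ k.1 := Iff.rfl

/-- Composition with permutations, in terms of points. -/
theorem T_rmul_pt (a : A) (p : U) (k h : ρ.G y) :
    ρ.T (a ⨟ h.1) p (ρ.pt (k * h)) ↔ ρ.T a p (ρ.pt k) := by
  rw [ρ.T_rmul]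
  constructor
  · rintro ⟨r, h1, h2⟩
    rwa [h.2.inj (ρ.T_pt_mul k h) h2]
  · exact fun h' => ⟨_, h', ρ.T_pt_mul k h⟩

theorem T_pt_rmul (a : A) (q : U) (g h : ρ.G x) :
    ρ.T (h.1 ⨟ a) (ρ.pt g) q ↔ ρ.T a (ρ.pt (g * h)) q := by
  rw [ρ.T_rmul]
  constructor
  · rintro ⟨r, h1, h2⟩
    rwa [h.2.func (ρ.T_pt_mul g h) h1]
  · exact fun h' => ⟨_, ρ.T_pt_mul g h, h'⟩

theorem isAtom_at₂_rmul (h : ρ.setoid x y) (k : ρ.G y) : IsAtom (ρ.at₂ x y ⨟ k.1) :=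
  isAtom_rmul k.2 (ρ.isAtom_at₂ h) fun _ _ h => (ρ.T_of_T_at₂ h).2

theorem isAtom_rmul_at₂ (h : ρ.setoid x y) (g : ρ.G x) : IsAtom (g.1 ⨟ ρ.at₂ x y) :=
  rmul_isAtom g.2 (ρ.isAtom_at₂ h) fun _ _ h => (ρ.T_of_T_at₂ h).1

/-- Both products in the definition of `M` are atoms, and the right one joins `base x` to `pt k`;
they are equal as soon as the left one does too. -/
theorem mem_M_iff (h : ρ.setoid x y) {g : ρ.G x} {k : ρ.G y} :
    (g, k) ∈ ρ.M x y ↔ ρ.T (ρ.at₂ x y) (ρ.pt g) (ρ.pt k) := by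
  have h1 : ρ.T (ρ.at₂ x y ⨟ k.1) (ρ.base x) (ρ.pt k) := by
    have := (ρ.T_rmul_pt (ρ.at₂ x y) (ρ.base x) 1 k).2 (by rw [pt_one]; exact ρ.T_at₂ h)
    rwa [one_mul] at this
  have h2 : ρ.T (g.1 ⨟ ρ.at₂ x y) (ρ.base x) (ρ.pt k) ↔ ρ.T (ρ.at₂ x y) (ρ.pt g) (ρ.pt k) := by
    have := ρ.T_pt_rmul (ρ.at₂ x y) (ρ.pt k) 1 g
    rwa [one_mul, pt_one] at this
  rw [mem_M, ← h2]
  constructor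
  · intro h'
    rwa [h']
  · intro h'
    exact ρ.eq_of_isAtom (ρ.isAtom_rmul_at₂ h g) (ρ.isAtom_at₂_rmul h k) h' h1

theorem exists_mem_M_left (x y : MeasurableAtom A) (g : ρ.G x) : ∃ k, (g, k) ∈ ρ.M x y := by
  by_cases h : ρ.setoid x y
  · obtain ⟨r, hr⟩ := exists_T_of_isAtom x.2.1 (ρ.T_base x) (ρ.T_at₂ h) (ρ.T_pt_self g)
    obtain ⟨k, rfl⟩ := ρ.exists_pt (ρ.T_of_T_at₂ hr).2 (ρ.T_top_trans (ρ.T_top_symm h)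
      (ρ.T_top_trans (ρ.T_top_base_pt g) (ρ.T_top hr)))
    exact ⟨k, (ρ.mem_M_iff h).2 hr⟩
  -- Here `at₂ x y = ⊥`, so both products vanish and `M x y` is the whole group.
  · refine ⟨1, ?_⟩
    rw [mem_M, at₂, dif_neg h]
    apply ρ.ext_of_T
    simp [ρ.T_rmul, ρ.not_T_bot]

theorem exists_mem_M_right (x y : MeasurableAtom A) (k : ρ.G y) : ∃ g, (g, k) ∈ ρ.M x y := by
  by_cases h : ρ.setoid x y
  · obtain ⟨r, hr⟩ := exists_T_of_isAtom y.2.1 (ρ.T_base y) ((ρ.T_conv _ _ _).2 (ρ.T_at₂ h))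
      (ρ.T_pt_self k)
    rw [ρ.T_conv] at hr
    obtain ⟨g, rfl⟩ := ρ.exists_pt (ρ.T_of_T_at₂ hr).1 (ρ.T_top_trans h
      (ρ.T_top_trans (ρ.T_top_base_pt k) (ρ.T_top_symm (ρ.T_top hr))))
    exact ⟨g, (ρ.mem_M_iff h).2 hr⟩
  · refine ⟨1, ?_⟩
    rw [mem_M, at₂, dif_neg h]
    apply ρ.ext_of_T
    simp [ρ.T_rmul, ρ.not_T_bot]

theorem mem_M_self {g k : ρ.G x} : (g, k) ∈ ρ.M x x ↔ g = k := by
  have : ρ.at₂ x x = x.1 := ρ.eq_of_isAtom (ρ.isAtom_at₂ (ρ.setoid.refl x)) x.2.1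
    (ρ.T_at₂ (ρ.setoid.refl x)) (ρ.T_base x)
  rw [mem_M, this]
  change (g * 1).1 = (1 * k).1 ↔ _
  rw [mul_one, one_mul]
  exact ⟨Subtype.ext, congrArg _⟩

theorem mem_M_symm (h : ρ.setoid x y) {g : ρ.G x} {k : ρ.G y} (hM : (g, k) ∈ ρ.M x y) :
    (k, g) ∈ ρ.M y x := by
  rw [ρ.mem_M_iff h] at hM
  rw [ρ.mem_M_iff (ρ.setoid.symm h)]
  exact ρ.T_mono (ρ.le_of_isAtom (ρ.isAtom_at₂ h) (ρ.T_at₂ h)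
    ((ρ.T_conv _ _ _).2 (ρ.T_at₂ (ρ.setoid.symm h)))) hM |> (ρ.T_conv _ _ _).1

theorem exists_mem_M_of_mem (h : ρ.setoid x y) (h' : ρ.setoid y z) {g : ρ.G x} {l : ρ.G z}
    (hM : (g, l) ∈ ρ.M x z) : ∃ k, (g, k) ∈ ρ.M x y ∧ (k, l) ∈ ρ.M y z := by
  have hxz := ρ.setoid.trans h h'
  rw [ρ.mem_M_iff hxz] at hM
  obtain ⟨r, h1, h2⟩ := (ρ.T_rmul _ _ _ _).1 <| ρ.T_mono (ρ.le_of_isAtom (ρ.isAtom_at₂ hxz)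
    (ρ.T_at₂ hxz) ((ρ.T_rmul _ _ _ _).2 ⟨_, ρ.T_at₂ h, ρ.T_at₂ h'⟩)) hM
  obtain ⟨k, rfl⟩ := ρ.exists_pt (ρ.T_of_T_at₂ h1).2 (ρ.T_top_trans (ρ.T_top_symm h)
      (ρ.T_top_trans (ρ.T_top_base_pt g) (ρ.T_top h1)))
  exact ⟨k, (ρ.mem_M_iff h).2 h1, (ρ.mem_M_iff h').2 h2⟩

theorem exists_isFrame : ∃ P : GroupPair (MeasurableAtom A) ρ.G, P.IsFrame ∧ P.equiv = ρ.setoid ∧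
    ∀ x y (h : P.equiv x y) (g : ρ.G x) (k : ρ.G y),
      P.φ x y h (QuotientGroup.mk g) = QuotientGroup.mk k ↔ (g, k) ∈ ρ.M x y :=
  GroupPair.exists_isFrame_of_subgroups ρ.setoid ρ.M ρ.exists_mem_M_left ρ.exists_mem_M_right
    (fun _ _ _ => ρ.mem_M_self) (fun _ _ _ _ h hM => ρ.mem_M_symm h hM)
    fun _ _ _ _ _ h h' hM => ρ.exists_mem_M_of_mem h h' hM


/-- The elements that relate two points of the form `pt g` and `pt k`. -/
theorem T_pt_pt_iff (h : ρ.setoid x y) {g : ρ.G x} {m : ρ.G y} (hM : (g, m) ∈ ρ.M x y) (b : A)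
    (n : ρ.G y) : ρ.T b (ρ.pt g) (ρ.pt (m * n)) ↔ ρ.at₂ x y ⨟ n.1 ≤ b := by
  have := (ρ.T_rmul_pt _ _ m n).2 ((ρ.mem_M_iff h).1 hM)
  exact ⟨fun h' => ρ.le_of_isAtom (ρ.isAtom_at₂_rmul h n) this h', fun h' => ρ.T_mono h' this⟩

/-! ### The dense embedding into the group relation algebra -/

section Frame

variable {ρ} {P : GroupPair (MeasurableAtom A) ρ.G} (hP : P.IsFrame) (hs : P.equiv = ρ.setoid)
  (hφ : ∀ x y (h : P.equiv x y) (g : ρ.G x) (k : ρ.G y),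
    P.φ x y h (QuotientGroup.mk g) = QuotientGroup.mk k ↔ (g, k) ∈ ρ.M x y)

include hφ in
-- `K x y` is the stabilizer of `at₂ x y` under right multiplication, so the atoms `at₂ x y ⨟ n` are
-- labelled by its cosets, as the atomic relations are.
theorem at₂_rmul_eq_iff (h : P.equiv x y) (n n' : ρ.G y) :
    ρ.at₂ x y ⨟ n.1 = ρ.at₂ x y ⨟ n'.1 ↔
      (QuotientGroup.mk n : ρ.G y ⧸ P.K x y) = QuotientGroup.mk n' := by
  have hK : (QuotientGroup.mk n : ρ.G y ⧸ P.K x y) = QuotientGroup.mk n' ↔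
      (1, n' * n⁻¹) ∈ ρ.M x y := by
    rw [← hφ x y h, QuotientGroup.mk_one, map_one, QuotientGroup.mk_mul, QuotientGroup.mk_inv,
      eq_comm (a := (1 : ρ.G y ⧸ P.K x y)), mul_inv_eq_one, eq_comm]
  rw [hK, mem_M, PermGroup.val_one, self_rmul_at₂]
  constructor
  · intro h
    rw [at₂_rmul_mul, ← h, ← at₂_rmul_mul, mul_inv_cancel, PermGroup.val_one, at₂_rmul_self]
  · intro h
    have := congrArg (· ⨟ n.1) h
    rwa [← at₂_rmul_mul, inv_mul_cancel_right] at this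

include hφ in
theorem at₂_rmul_eq_iff_φ (h : P.equiv x y) {g g' : ρ.G x} {m m' : ρ.G y}
    (hM : (g, m) ∈ ρ.M x y) (hM' : (g', m') ∈ ρ.M x y) (n n' : ρ.G y) :
    ρ.at₂ x y ⨟ n.1 = ρ.at₂ x y ⨟ n'.1 ↔
      (P.φ x y h (QuotientGroup.mk g))⁻¹ * QuotientGroup.mk (m * n) =
        (P.φ x y h (QuotientGroup.mk g'))⁻¹ * QuotientGroup.mk (m' * n') := by
  rw [at₂_rmul_eq_iff hφ h, (hφ x y h g m).2 hM, (hφ x y h g' m').2 hM', QuotientGroup.mk_mul,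
    QuotientGroup.mk_mul, inv_mul_cancel_left, inv_mul_cancel_left]

/-- The relation on the base set of the frame that corresponds to an element. -/
noncomputable def toRel (P : GroupPair (MeasurableAtom A) ρ.G) (b : A) : SetRel P.Base P.Base :=
  {w | ρ.T b (ρ.pt w.1.2) (ρ.pt w.2.2)}

include hs hφ in
theorem toRel_mem (b : A) : toRel P b ∈ P.unions := by
  rw [GroupPair.mem_unions_iff]
  refine ⟨?_, ?_⟩
  · rintro ⟨x, g⟩ ⟨y, k⟩ h
    change P.equiv x y
    rw [hs]
    exact (ρ.T_top_pt_iff g k).1 (ρ.T_top h)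
  · intro x y h g g' k k' he hT
    have h' : ρ.setoid x y := hs ▸ h
    obtain ⟨m, hm⟩ := ρ.exists_mem_M_left x y g
    obtain ⟨m', hm'⟩ := ρ.exists_mem_M_left x y g'
    -- With `(g, m)` in `M x y`, the atom through `(pt g, pt (m * n))` is `at₂ x y ⨟ n`.
    obtain ⟨n, rfl⟩ : ∃ n, k = m * n := ⟨m⁻¹ * k, by simp⟩
    obtain ⟨n', rfl⟩ : ∃ n, k' = m' * n := ⟨m'⁻¹ * k', by simp⟩
    rw [← at₂_rmul_eq_iff_φ hφ h hm hm'] at he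
    exact (ρ.T_pt_pt_iff h' hm' b n').2 (he ▸ (ρ.T_pt_pt_iff h' hm b n).1 hT)

theorem sigma_eq_of_pt_eq {v w : P.Base} (h : ρ.pt v.2 = ρ.pt w.2) : v = w := by
  obtain ⟨x, g⟩ := v
  obtain ⟨y, k⟩ := w
  have hx := ρ.T_pt_self g
  have hy := ρ.T_pt_self k
  dsimp only at h
  obtain rfl : x = y := Subtype.ext (ρ.eq_of_isAtom x.2.1 y.2.1 hx (h ▸ hy))
  rw [ρ.pt_injective h]

theorem isHom_toRel :
    IsHom (B := (P.groupRelationAlgebra hP).Elem) fun b => ⟨toRel P b, toRel_mem hs hφ b⟩ where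
  map_sup a b := SetRelationAlgebra.Elem.ext _ fun p => ρ.T_sup a b _ _
  map_compl a := SetRelationAlgebra.Elem.ext _ fun p => by
    refine (ρ.T_compl a _ _).trans (and_congr ?_ Iff.rfl)
    rw [T_top_pt_iff]
    change _ ↔ P.equiv p.1.1 p.2.1
    rw [hs]
    rfl
  map_rmul a b := SetRelationAlgebra.Elem.ext _ fun p => by
    refine (ρ.T_rmul a b _ _).trans ⟨?_, ?_⟩
    · rintro ⟨r, h1, h2⟩
      obtain ⟨z, l, rfl⟩ := ρ.exists_pt_of_T rfl h1
      exact ⟨⟨z, l⟩, h1, h2⟩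
    · rintro ⟨w, h1, h2⟩
      exact ⟨_, h1, h2⟩
  map_conv a := SetRelationAlgebra.Elem.ext _ fun p => ρ.T_conv a _ _
  map_ident := SetRelationAlgebra.Elem.ext _ fun p => by
    refine (ρ.T_ident _ _).trans ⟨fun h => sigma_eq_of_pt_eq h, fun h => ?_⟩
    have : p.1 = p.2 := h
    rw [this]

/-- Passing to the points `pt g` loses no element: uniformity moves any pair of `b` to one starting
at a base point. -/
theorem exists_mem_toRel {b : A} (hb : b ≠ ⊥) : ∃ w, w ∈ toRel P b := by
  obtain ⟨p, q, hpq⟩ := ρ.exists_T hb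
  obtain ⟨x, hx⟩ := ρ.exists_atom p
  obtain ⟨r, hr⟩ := exists_T_of_isAtom x.2.1 hx hpq (ρ.T_base x)
  rw [← pt_one] at hr
  obtain ⟨y, k, rfl⟩ := ρ.exists_pt_of_T rfl hr
  exact ⟨(⟨x, 1⟩, ⟨y, k⟩), hr⟩

include hs hφ in
theorem exists_toRel_subset {R : SetRel P.Base P.Base} (hR : R ∈ P.unions) {w : P.Base × P.Base}
    (hw : w ∈ R) : ∃ b : A, w ∈ toRel P b ∧ toRel P b ⊆ R := by
  obtain ⟨⟨x, g⟩, ⟨y, k⟩⟩ := w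
  rw [GroupPair.mem_unions_iff] at hR
  have h : P.equiv x y := hR.1 _ _ hw
  have h' : ρ.setoid x y := hs ▸ h
  obtain ⟨m, hm⟩ := ρ.exists_mem_M_left x y g
  obtain ⟨n, rfl⟩ : ∃ n, k = m * n := ⟨m⁻¹ * k, by simp⟩
  refine ⟨ρ.at₂ x y ⨟ n.1, (ρ.T_pt_pt_iff h' hm _ n).2 le_rfl, ?_⟩
  rintro ⟨⟨x', g'⟩, ⟨y', k'⟩⟩ hT
  obtain ⟨r, h1, h2⟩ := (ρ.T_rmul _ _ _ _).1 hT
  obtain rfl : x = x' := Subtype.ext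
    (ρ.eq_of_isAtom x.2.1 x'.2.1 (ρ.T_of_T_at₂ h1).1 (ρ.T_pt_self g'))
  obtain rfl : y = y' := Subtype.ext
    (ρ.eq_of_isAtom y.2.1 y'.2.1 (n.2.right h2) (ρ.T_pt_self k'))
  obtain ⟨m', hm'⟩ := ρ.exists_mem_M_left x y g'
  obtain ⟨n', rfl⟩ : ∃ n, k' = m' * n := ⟨m'⁻¹ * k', by simp⟩
  refine hR.2 x y h g g' _ _ ?_ hw
  have hle := (ρ.T_pt_pt_iff h' hm' _ n').1 hT
  rw [← at₂_rmul_eq_iff_φ hφ h hm hm']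
  exact (((ρ.isAtom_at₂_rmul h' n).le_iff.1 hle).resolve_left (ρ.isAtom_at₂_rmul h' n').1).symm

end Frame

end BasedRep

end RelationAlgebra

/-! ### Sums in group relation algebras are unions -/

namespace GroupPair

variable {I : Type u} {G : I → Type u} [∀ x, Group (G x)] {P : GroupPair I G} (hP : P.IsFrame)

theorem iUnion_mem_unions (X : Set (P.groupRelationAlgebra hP).Elem) :
    (⋃ b ∈ X, b.rel) ∈ P.unions := by
  choose T hT hT' using fun b : (P.groupRelationAlgebra hP).Elem => b.2
  refine ⟨⋃ b ∈ X, T b, Set.iUnion₂_subset fun b _ => hT b, ?_⟩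
  simp only [Set.sUnion_iUnion]
  exact Set.iUnion₂_congr fun b _ => hT' b

theorem isLUB_iUnion (X : Set (P.groupRelationAlgebra hP).Elem) :
    IsLUB X (⟨⋃ b ∈ X, b.rel, iUnion_mem_unions hP X⟩ : (P.groupRelationAlgebra hP).Elem) :=
  ⟨fun b hb _ hp => Set.mem_biUnion hb hp, fun c hc p hp => by
    obtain ⟨b, hb, hbp⟩ := Set.mem_iUnion₂.1 hp
    exact hc hb p hbp⟩

theorem isComplete_groupRelationAlgebra :
    RelationAlgebra.IsComplete (P.groupRelationAlgebra hP).Elem :=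
  fun X => ⟨_, isLUB_iUnion hP X⟩

theorem rel_eq_of_isLUB {X : Set (P.groupRelationAlgebra hP).Elem}
    {a : (P.groupRelationAlgebra hP).Elem} (h : IsLUB X a) : a.rel = ⋃ b ∈ X, b.rel := by
  rw [h.unique (isLUB_iUnion hP X)]
  rfl

end GroupPair

/-! ### Homomorphisms, completions and preservation of sums -/

namespace RelationAlgebra

variable {A B C : Type u} [RelationAlgebra A] [RelationAlgebra B] [RelationAlgebra C]

theorem IsHom.comp {g : B → C} {f : A → B} (hg : IsHom g) (hf : IsHom f) : IsHom (g ∘ f) where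
  map_sup a b := by simp only [Function.comp_apply, hf.map_sup, hg.map_sup]
  map_compl a := by simp only [Function.comp_apply, hf.map_compl, hg.map_compl]
  map_rmul a b := by simp only [Function.comp_apply, hf.map_rmul, hg.map_rmul]
  map_conv a := by simp only [Function.comp_apply, hf.map_conv, hg.map_conv]
  map_ident := by simp only [Function.comp_apply, hf.map_ident, hg.map_ident]

theorem IsHom.mono {f : A → B} (hf : IsHom f) : Monotone f := fun a b h => by
  rw [← sup_eq_right.2 h, hf.map_sup]
  exact le_sup_left

theorem IsHom.map_inf {f : A → B} (hf : IsHom f) (a b : A) : f (a ⊓ b) = f a ⊓ f b := by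
  rw [← compl_compl (a ⊓ b), compl_inf, hf.map_compl, hf.map_sup, hf.map_compl, hf.map_compl,
    compl_sup, compl_compl, compl_compl]

theorem IsHom.map_bot {f : A → B} (hf : IsHom f) : f ⊥ = ⊥ := by
  rw [← inf_compl_self (⊥ : A), hf.map_inf, hf.map_compl, inf_compl_self]

theorem IsHom.le_iff {f : A → B} (hf : IsHom f) (hinj : Function.Injective f) {a b : A} :
    f a ≤ f b ↔ a ≤ b := by
  rw [← sup_eq_right, ← hf.map_sup, hinj.eq_iff, sup_eq_right]

theorem IsHom.injective {f : A → B} (hf : IsHom f) (h : ∀ a, f a = ⊥ → a = ⊥) :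
    Function.Injective f := by
  have key : ∀ a b, f a = f b → a ≤ b := fun a b hab => by
    rw [← disjoint_compl_right_iff, disjoint_iff]
    apply h
    rw [hf.map_inf, hf.map_compl, hab, inf_compl_self]
  exact fun a b hab => le_antisymm (key a b hab) (key b a hab.symm)

/-- A dense embedding preserves all existing sums. -/
theorem IsCompletion.isLUB_image {e : A → B} (he : IsCompletion e) {X : Set A} {a : A}
    (h : IsLUB X a) : IsLUB (e '' X) (e a) := by
  refine ⟨he.hom.mono.mem_upperBounds_image h.1, fun b hb => ?_⟩
  rw [← disjoint_compl_right_iff, disjoint_iff]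
  by_contra hne
  -- If an upper bound `b` failed to cover `e a`, density would give a nonzero `c ≤ a` disjoint from
  -- all of `X`; then `cᶜ` bounds `X` and `a ≤ cᶜ`.
  obtain ⟨c, hc, hcle⟩ := he.dense _ hne
  have hca : c ≤ a := (he.hom.le_iff he.injective).1 (hcle.trans inf_le_left)
  have hac : a ≤ cᶜ := h.2 fun d hd => by
    rw [← he.hom.le_iff he.injective, he.hom.map_compl, le_compl_comm]
    exact hcle.trans (inf_le_right.trans (compl_le_compl (hb ⟨d, hd, rfl⟩)))
  exact hc (le_compl_self.1 (hca.trans hac))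

theorem IsIso.isLUB_image {f : A → B} (hf : IsIso f) {X : Set A} {a : A} (h : IsLUB X a) :
    IsLUB (f '' X) (f a) := by
  refine ⟨hf.1.mono.mem_upperBounds_image h.1, fun b hb => ?_⟩
  obtain ⟨c, rfl⟩ := hf.2.2 b
  exact hf.1.mono (h.2 fun d hd => (hf.1.le_iff hf.2.1).1 (hb ⟨d, hd, rfl⟩))

/-- The join of all `a` with `e a ≤ b` exists and is preserved by `e`; by density nothing of `b` is
left over. -/
theorem IsCompletion.surjective_of_finite [Finite A] {e : A → B} (he : IsCompletion e) :
    Function.Surjective e := by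
  intro b
  have hfin : {a : A | e a ≤ b}.Finite := Set.toFinite _
  obtain ⟨a, ha⟩ : ∃ a : A, IsLUB {a : A | e a ≤ b} a :=
    ⟨_, by simpa using (hfin.toFinset.isLUB_sup_id)⟩
  refine ⟨a, le_antisymm ?_ ?_⟩
  · refine (he.isLUB_image ha).2 ?_
    rintro _ ⟨c, hc, rfl⟩
    exact hc
  · rw [← disjoint_compl_right_iff, disjoint_iff]
    by_contra hne
    obtain ⟨c, hc, hcle⟩ := he.dense _ hne
    have hca : c ≤ a := ha.1 (hcle.trans inf_le_left)
    have hca' : c ≤ aᶜ := by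
      rw [← he.hom.le_iff he.injective, he.hom.map_compl]
      exact hcle.trans inf_le_right
    exact hc (le_bot_iff.1 ((le_inf hca hca').trans (inf_compl_self a).le))

/-- The image of an algebra under a homomorphism into a set relation algebra. -/
def IsHom.image {U : Type u} {S : SetRelationAlgebra U} {f : A → S.Elem} (hf : IsHom f) :
    SetRelationAlgebra U where
  E := S.E
  carrier := Set.range fun a => (f a).rel
  rel_of_mem := by
    rintro _ ⟨a, rfl⟩ p q h
    exact (f a).related _ h
  union_mem := by
    rintro _ ⟨a, rfl⟩ _ ⟨b, rfl⟩
    exact ⟨a ⊔ b, congrArg Subtype.val (hf.map_sup a b)⟩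
  compl_mem := by
    rintro _ ⟨a, rfl⟩
    exact ⟨aᶜ, congrArg Subtype.val (hf.map_compl a)⟩
  comp_mem := by
    rintro _ ⟨a, rfl⟩ _ ⟨b, rfl⟩
    exact ⟨a ⨟ b, congrArg Subtype.val (hf.map_rmul a b)⟩
  inv_mem := by
    rintro _ ⟨a, rfl⟩
    exact ⟨conv a, congrArg Subtype.val (hf.map_conv a)⟩
  id_mem := ⟨ident, congrArg Subtype.val hf.map_ident⟩

theorem IsHom.isIso_image {U : Type u} {S : SetRelationAlgebra U} {f : A → S.Elem}
    (hf : IsHom f) (hinj : Function.Injective f) :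
    IsIso (B := hf.image.Elem) fun a => ⟨(f a).rel, a, rfl⟩ := by
  refine ⟨⟨?_, ?_, ?_, ?_, ?_⟩, fun a b h => ?_, ?_⟩
  · exact fun a b => Subtype.ext (show (f (a ⊔ b)).rel = (f a ⊔ f b).rel by rw [hf.map_sup])
  · exact fun a => Subtype.ext (show (f aᶜ).rel = (f a)ᶜ.rel by rw [hf.map_compl])
  · exact fun a b => Subtype.ext (show (f (a ⨟ b)).rel = (f a ⨟ f b).rel by rw [hf.map_rmul])
  · exact fun a => Subtype.ext (show (f (conv a)).rel = (conv (f a)).rel by rw [hf.map_conv])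
  · exact Subtype.ext (show (f ident).rel = (ident : S.Elem).rel by rw [hf.map_ident])
  · exact hinj (Subtype.ext (show (f a).rel = (f b).rel from
      congrArg (SetRelationAlgebra.Elem.rel (S := hf.image)) h))
  · rintro ⟨_, a, rfl⟩
    exact ⟨a, rfl⟩

theorem EssentiallyIsomorphic.completelyRepresentable {I : Type u} {G : I → Type u}
    [∀ x, Group (G x)] {P : GroupPair I G} {hP : P.IsFrame}
    (h : EssentiallyIsomorphic A (P.groupRelationAlgebra hP).Elem) :
    CompletelyRepresentable A := by
  obtain ⟨B, _, e, he, ψ, hψ⟩ := h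
  have hf : IsHom (ψ ∘ e) := hψ.1.comp he.hom
  refine ⟨P.Base, hf.image, _, hf.isIso_image (hψ.2.1.comp he.injective), fun X a ha => ?_⟩
  have := GroupPair.rel_eq_of_isLUB hP (hψ.isLUB_image (he.isLUB_image ha))
  simp only [Set.biUnion_image] at this
  exact this

/-- Every sum is an iterated binary join, which any representation sends to a union. -/
theorem Representable.completelyRepresentable [Finite A] (h : Representable A) :
    CompletelyRepresentable A := by
  obtain ⟨U, S, θ, hθ⟩ := h
  refine ⟨U, S, θ, hθ, fun X a ha => ?_⟩
  have hfin : X.Finite := Set.toFinite _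
  induction X, hfin using Set.Finite.induction_on generalizing a with
  | empty =>
    rw [(isLUB_empty_iff.1 ha).eq_bot, hθ.1.map_bot]
    simp only [Set.mem_empty_iff_false, Set.iUnion_false, Set.iUnion_empty]
    rfl
  | @insert b X _ hX ih =>
    obtain ⟨c, hc⟩ : ∃ c : A, IsLUB X c := ⟨_, by simpa using (hX.toFinset.isLUB_sup_id)⟩
    rw [ha.unique (hc.insert b), hθ.1.map_sup, Set.biUnion_insert, ← ih c hc]
    rfl

theorem CompletelyRepresentable.exists_isCompletion (hA : IsMeasurableAlgebra A)
    (h : CompletelyRepresentable A) :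
    ∃ (I : Type u) (G : I → Type u) (_ : ∀ x, Group (G x)) (P : GroupPair I G) (hP : P.IsFrame)
      (e : A → (P.groupRelationAlgebra hP).Elem), IsCompletion e := by
  obtain ⟨U, ⟨ρ₀⟩⟩ := h.exists_completeRep
  obtain ⟨b, hb, hb'⟩ := ρ₀.exists_base
  let ρ : BasedRep A U := ⟨ρ₀, b, hb, hb', CompleteRep.exists_measurableAtom hA⟩
  obtain ⟨P, hP, hs, hφ⟩ := ρ.exists_isFrame
  have hhom := BasedRep.isHom_toRel hP hs hφ
  refine ⟨_, _, inferInstance, P, hP, _, GroupPair.isComplete_groupRelationAlgebra hP, hhom,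
    hhom.injective fun a ha => ?_, fun R hR => ?_⟩
  · by_contra hne
    obtain ⟨w, hw⟩ := BasedRep.exists_mem_toRel (P := P) hne
    have : w ∈ SetRelationAlgebra.Elem.rel (⊥ : (P.groupRelationAlgebra hP).Elem) := ha ▸ hw
    exact this
  · obtain ⟨w, hw⟩ : ∃ w, w ∈ R.rel := by
      by_contra! hno
      exact hR (le_bot_iff.1 fun w hw => (hno w hw).elim)
    obtain ⟨b, hwb, hbR⟩ := BasedRep.exists_toRel_subset hs hφ R.2 hw
    refine ⟨b, ?_, fun w h => hbR h⟩
    rintro rfl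
    exact ρ.not_T_bot _ _ hwb

end RelationAlgebra

theorem mainTheorem4 {A : Type u} [RelationAlgebra A]
    (hA : RelationAlgebra.IsMeasurableAlgebra A) :
    (RelationAlgebra.CompletelyRepresentable A ↔
      ∃ (I : Type u) (G : I → Type u) (_ : ∀ x, Group (G x)) (P : GroupPair I G) (hP : P.IsFrame),
        RelationAlgebra.EssentiallyIsomorphic A (P.groupRelationAlgebra hP).Elem) ∧
    (Finite A → RelationAlgebra.Representable A →
      ∃ (I : Type u) (G : I → Type u) (_ : ∀ x, Group (G x)) (P : GroupPair I G) (hP : P.IsFrame),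
        RelationAlgebra.Isomorphic A (P.groupRelationAlgebra hP).Elem) := by
  refine ⟨⟨fun h => ?_, ?_⟩, fun _ h => ?_⟩
  · obtain ⟨I, G, _, P, hP, e, he⟩ := h.exists_isCompletion hA
    exact ⟨I, G, _, P, hP, _, _, e, he, id, ⟨fun _ _ => rfl, fun _ => rfl, fun _ _ => rfl,
      fun _ => rfl, rfl⟩, Function.bijective_id⟩
  · rintro ⟨I, G, _, P, hP, h⟩
    exact h.completelyRepresentable
  · obtain ⟨I, G, _, P, hP, e, he⟩ := h.completelyRepresentable.exists_isCompletion hA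
    exact ⟨I, G, _, P, hP, e, he.hom, he.injective, he.surjective_of_finite⟩
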